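/- Let $\{0,1\}^*$ be the set of finite binary strings. An oracle (or language) is a subset of $\{0,1\}^*$. Oracle Turing machines are deterministic multitape machines with a query tape; once a string $w$ is written on the query tape, the machine can ask in one step whether $w$ belongs to the oracle. For $f:\{0,1\}^*\to\mathbb{N}$, a machine decides a language $L$ in time $f$ if on every input $x\in\{0,1\}^*$ it halts within $f(x)$ steps and accepts exactly when $x\in L$. An oracle $X$ is low for speed if for every computable language $L$, every oracle Turing machine $M$ and every function $f$ such that $M$ with oracle $X$ decides $L$ in time $f$, there are a Turing machine $M'$ without oracle and a polynomial $p$ such that $M'$ decides $L$ in time $p\circ f$. Theorem. There exists a non-computable oracle $X$ which is low for speed. Moreover, $X$ can be taken to be a subset of $\{0^{2^n} : n\in\mathbb{N}\}$ that is computable relative to the halting problem $\emptyset'$. -/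

import Mathlib

open Turing

/-- The instructions of an oracle Turing machine with state set `Q`, work tapes indexed by `K` and
work tape alphabet `Γ`. A head movement is an `Option Dir`, where `none` means "do not move". -/
inductive OracleInstr (Q K Γ : Type) : Type
  /-- Halt and reject (`false`, output `0`) or accept (`true`, output `1`). -/
  | halt (b : Bool)
  /-- Move the input head; on the query tape and on every work tape, write a symbol and then move
  the head; go to state `next`. -/
  | act (next : Q) (inMove : Option Dir) (queryAct : Option Bool × Option Dir)
      (workAct : K → Γ × Option Dir)
  /-- Ask the oracle about the string written on the query tape; go to the state `next answer`. -/
  | query (next : Bool → Q)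

/-- A deterministic multitape oracle Turing machine, with a read-only input tape and a read/write
query tape over `{blank, 0, 1}` (`Option Bool`, with blank `none`), and finitely many read/write
work tapes over a finite alphabet `Γ` with blank symbol `default`. The instruction executed depends
on the state and on the scanned symbols of the input tape, the query tape and the work tapes. -/
structure OracleTM where
  Q : Type
  K : Type
  Γ : Type
  [finiteQ : Finite Q]
  [finiteK : Finite K]
  [finiteΓ : Finite Γ]
  [inhabitedΓ : Inhabited Γ]
  start : Q
  instr : Q → Option Bool → Option Bool → (K → Γ) → OracleInstr Q K Γ

namespace OracleTM

attribute [instance] finiteQ finiteK finiteΓ inhabitedΓ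

/-- A configuration: state and tapes (a `Tape` is two-way infinite and includes its head). -/
structure Cfg (M : OracleTM) where
  state : M.Q
  input : Tape (Option Bool)
  query : Tape (Option Bool)
  work : M.K → Tape M.Γ

/-- Optional head movement. -/
def moveHead {A : Type} [Inhabited A] (d : Option Dir) (T : Tape A) : Tape A :=
  match d with
  | none => T
  | some d => T.move d

/-- Write a symbol, then move the head. -/
def actOn {A : Type} [Inhabited A] (a : A × Option Dir) (T : Tape A) : Tape A :=
  moveHead a.2 (T.write a.1)

/-- The string written on the tape `T`, from the scanned cell rightwards up to the first blank
cell, is `w`. (Here `w[i]?` is `some` of the `i`-th bit of `w` if `i < w.length`, and it is the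
blank `none` if `i = w.length`.) -/
def Spells (T : Tape (Option Bool)) (w : List Bool) : Prop :=
  ∀ i : ℕ, i ≤ w.length → T.nth (i : ℤ) = w[i]?

open Classical in
/-- The answer of the oracle `X` to the query written on the tape `T`. -/
noncomputable def answer (X : Set (List Bool)) (T : Tape (Option Bool)) : Bool :=
  decide (∃ w ∈ X, Spells T w)

/-- The initial configuration on input `x`: the input head is on the first symbol of `x`, all other
tapes are blank. -/
def init (M : OracleTM) (x : List Bool) : M.Cfg where
  state := M.start
  input := Tape.mk₁ (x.map some)
  query := Tape.mk₁ []
  work := fun _ => Tape.mk₁ []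

/-- One step of computation of `M` with oracle `X`: either the next configuration, or the output. -/
noncomputable def step (M : OracleTM) (X : Set (List Bool)) (c : M.Cfg) : M.Cfg ⊕ Bool :=
  match M.instr c.state c.input.head c.query.head (fun k => (c.work k).head) with
  | .halt b => .inr b
  | .act next inMove queryAct workAct =>
      .inl { state := next
             input := moveHead inMove c.input
             query := actOn queryAct c.query
             work := fun k => actOn (workAct k) (c.work k) }
  | .query next => .inl { c with state := next (answer X c.query) }

/-- The output of `M` with oracle `X` when started in configuration `c`, if it halts within `t`
steps, and `none` otherwise. -/
noncomputable def run (M : OracleTM) (X : Set (List Bool)) : ℕ → M.Cfg → Option Bool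
  | 0, _ => none
  | t + 1, c =>
    match M.step X c with
    | .inl c' => M.run X t c'
    | .inr b => some b

open Classical in
/-- `M` with oracle `X` decides the language `L` in time `f`: on every input string `x` it halts
within `f x` steps, with the correct output. -/
def DecidesInTime (M : OracleTM) (X L : Set (List Bool)) (f : List Bool → ℕ) : Prop :=
  ∀ x, M.run X (f x) (M.init x) = some (decide (x ∈ L))

/-- `M` is a machine without oracle: it has no query instruction. -/
def OracleFree (M : OracleTM) : Prop :=
  ∀ q a b s next, M.instr q a b s ≠ .query next

end OracleTM

/-- `X` is low for speed: whenever a computable language `L` is decided in time `f` by a machine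
with oracle `X`, it is decided in time `p ∘ f` by a machine without oracle, for some polynomial `p`.
(A machine without oracle is run with the empty oracle, which it never queries.) -/
def LowForSpeed (X : Set (List Bool)) : Prop :=
  ∀ L : Set (List Bool), ComputablePred (fun x => x ∈ L) →
    ∀ (M : OracleTM) (f : List Bool → ℕ), M.DecidesInTime X L f →
      ∃ (M' : OracleTM) (p : Polynomial ℕ),
        M'.OracleFree ∧ M'.DecidesInTime ∅ L (fun x => p.eval (f x))

open Classical in
/-- The halting problem `∅' = {e | φₑ(e) halts}`, as a characteristic function. -/
noncomputable def haltingProblem : ℕ → ℕ := fun e =>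
  if ((Denumerable.ofNat Nat.Partrec.Code e).eval e).Dom then 1 else 0

open Classical in
/-- `X` is Turing reducible to the halting problem. -/
def ComputableInHaltingProblem (X : Set (List Bool)) : Prop :=
  ComputableIn {(haltingProblem : ℕ →. ℕ)} (fun x : List Bool => decide (x ∈ X))

/-- The set of strings `{0^(2^n) | n ∈ ℕ}`. -/
def sparseStrings : Set (List Bool) := {x | ∃ n : ℕ, x = List.replicate (2 ^ n) false}

/-! The oracle is `X = {0^(2^k) : B k}` for a sufficiently generic sequence `B` (`Generic.limit`),
built by finite extensions: stage `s + 1` appends `φ_s(stage s)` when this is defined. Hence every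
partial computable `g` on strings has an initial segment `σ` of `B` such that, if `g σ` is defined,
then `B` also extends `σ` followed by `g σ` (`Generic.limit_generic`). The only non-effective
question in the construction is whether `φ_s(stage s)` is defined, so `B` is computable from the
halting problem. If `X` were computable, then `g σ` could be the negation of bit `|σ|` of `B`, which
is absurd.

For lowness, let `M` with oracle `X` decide a computable `L` in time `f`. Let `g σ` search for `ρ`,
`t`, `x` such that `M`, with the finite oracle given by `σρ`, halts on `x` within `t` steps with the
wrong answer, and return `ρ` followed by `t` zeros. A successful search from the `σ` of genericity
would force the same wrong answer with oracle `X`. So it fails: no finite oracle extending `σ` ever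
makes `M` err. An oracle-free machine can therefore try all these oracles and trust the first
answer.

Sparseness makes this fast. In `N` steps only strings of length at most `N` can be queried
(`OracleTM.run_init_congr`), which involves about `log N` bits of `B`, hence about `N` oracles, each
simulated for `N` steps. The search doubles `N` until some simulation halts. This happens at the
latest when `N` exceeds `f x`, since a truncation of `X` is then among the oracles; the total time
is polynomial in `f x`, although `f` is unknown to the machine
(`OracleTM.Search.exists_oracleFree_of_forall_bitOracle`).

The searching machine is explicit. One tape holds the current oracle, whose variable bits form a
binary counter; another is a clock of `N` cells which also records what each simulated step
overwrote. The simulation can thus be reversed, so that `M` restarts from its initial configuration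
with the next oracle. -/

namespace MixedTM

/-! ### Programs with work tapes over different alphabets -/

/-- Optionally write a symbol, then optionally move the head. -/
def optAct {A : Type} [Inhabited A] (a : Option A × Option Dir) (T : Tape A) : Tape A :=
  OracleTM.moveHead a.2 (match a.1 with
    | none => T
    | some s => T.write s)

/-- What a `MixedTM` does in one step if it does not halt. By default, a tape is left alone. -/
structure Act (S K Γ A B : Type) where
  next : S
  inMove : Option Dir := none
  queryAct : Option (Option Bool) × Option Dir := (none, none)
  fstAct : Option A × Option Dir := (none, none)
  sndAct : Option B × Option Dir := (none, none)
  workAct : K → Option Γ × Option Dir := fun _ => (none, none)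

/-- Configurations of machines with work tapes indexed by `K` over `Γ`, and two
more work tapes over the alphabets `A` and `B`. -/
structure Cfg (S K Γ A B : Type) [Inhabited Γ] [Inhabited A] [Inhabited B] where
  state : S
  input : Tape (Option Bool)
  query : Tape (Option Bool)
  fst : Tape A
  snd : Tape B
  work : K → Tape Γ

/-- The transition function of an oracle-free machine with mixed work alphabets. -/
abbrev Program (S K Γ A B : Type) :=
  S → Option Bool → Option Bool → A → B → (K → Γ) → Act S K Γ A B ⊕ Bool

variable {S K Γ A B : Type} [Inhabited Γ] [Inhabited A] [Inhabited B]

/-- Apply an action to the tapes. -/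
def Act.apply (a : Act S K Γ A B) (c : Cfg S K Γ A B) : Cfg S K Γ A B where
  state := a.next
  input := OracleTM.moveHead a.inMove c.input
  query := optAct a.queryAct c.query
  fst := optAct a.fstAct c.fst
  snd := optAct a.sndAct c.snd
  work := fun k => optAct (a.workAct k) (c.work k)

/-- One step of computation. -/
def step (δ : Program S K Γ A B) (c : Cfg S K Γ A B) : Cfg S K Γ A B ⊕ Bool :=
  (δ c.state c.input.head c.query.head c.fst.head c.snd.head fun k => (c.work k).head).map
    (fun a => a.apply c) id

/-- The program halts within `t` steps from the configuration `c`, with output `b`. -/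
def HaltsIn (δ : Program S K Γ A B) : ℕ → Cfg S K Γ A B → Bool → Prop
  | 0, _, _ => False
  | t + 1, c, b => Sum.elim (fun c' => HaltsIn δ t c' b) (fun b' => b' = b) (step δ c)

theorem HaltsIn.mono {δ : Program S K Γ A B} {t t' : ℕ} {c : Cfg S K Γ A B} {b : Bool}
    (h : HaltsIn δ t c b) (ht : t ≤ t') : HaltsIn δ t' c b := by
  induction t generalizing t' c with
  | zero => exact h.elim
  | succ t ih =>
    obtain ⟨t', rfl⟩ : ∃ s, t' = s + 1 := ⟨t' - 1, by omega⟩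
    unfold HaltsIn at h ⊢
    cases hs : step δ c with
    | inl c' =>
      rw [hs] at h
      exact ih h (by omega)
    | inr b' =>
      rw [hs] at h
      exact h

/-- Running times are derived backwards: a phase of a program assumes that its final configuration
halts in time `t` and adds its own cost to `t`. Phases then compose without any description of
intermediate runs. -/
theorem HaltsIn.cons {δ : Program S K Γ A B} {t : ℕ} {c c' : Cfg S K Γ A B} {b : Bool}
    (h : HaltsIn δ t c' b) (hs : step δ c = .inl c') : HaltsIn δ (t + 1) c b := by
  unfold HaltsIn
  rw [hs]
  exact h

theorem HaltsIn.of_halt {δ : Program S K Γ A B} {c : Cfg S K Γ A B} {b : Bool}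
    (hs : step δ c = .inr b) : HaltsIn δ 1 c b := by
  unfold HaltsIn
  rw [hs]
  rfl

/-- Symbols of an ordinary work tape, as symbols of the product alphabet. -/
def embWork : PointedMap Γ (Γ × A × B) := ⟨fun g => (g, default, default), rfl⟩

/-- Symbols of the first extra tape, as symbols of the product alphabet. -/
def embFst : PointedMap A (Γ × A × B) := ⟨fun a => (default, a, default), rfl⟩

/-- Symbols of the second extra tape, as symbols of the product alphabet. -/
def embSnd : PointedMap B (Γ × A × B) := ⟨fun b => (default, default, b), rfl⟩

/-- The instruction over the product alphabet that corresponds to an action, where `w` are the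
scanned symbols of the work tapes and `s` is that of the query tape. -/
def toInstr (s : Option Bool) (w : Option (Option K) → Γ × A × B) :
    Act S K Γ A B ⊕ Bool → OracleInstr S (Option (Option K)) (Γ × A × B)
  | .inr b => .halt b
  | .inl act => .act act.next act.inMove (act.queryAct.1.getD s, act.queryAct.2) fun
    | none => (embFst (act.fstAct.1.getD (w none).2.1), act.fstAct.2)
    | some none => (embSnd (act.sndAct.1.getD (w (some none)).2.2), act.sndAct.2)
    | some (some k) => (embWork ((act.workAct k).1.getD (w (some (some k))).1), (act.workAct k).2)

/-- The oracle Turing machine (which asks no query) executing a program; it has the single work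
alphabet `Γ × A × B`. -/
def toOracleTM [Finite S] [Finite K] [Finite Γ] [Finite A] [Finite B] (start : S)
    (δ : Program S K Γ A B) : OracleTM where
  Q := S
  K := Option (Option K)
  Γ := Γ × A × B
  start := start
  instr q a b w := toInstr b w
    (δ q a b (w none).2.1 (w (some none)).2.2 (fun k => (w (some (some k))).1))

variable [Finite S] [Finite K] [Finite Γ] [Finite A] [Finite B]

theorem toOracleTM_oracleFree (start : S) (δ : Program S K Γ A B) :
    (toOracleTM start δ).OracleFree := by
  intro q a b s next
  change toInstr _ _ _ ≠ _
  generalize δ q a b _ _ _ = r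
  cases r <;> exact nofun

/-- The configuration of `toOracleTM start δ` that represents `c`. -/
def emb (start : S) (δ : Program S K Γ A B) (c : Cfg S K Γ A B) : (toOracleTM start δ).Cfg where
  state := c.state
  input := c.input
  query := c.query
  work := fun
    | none => c.fst.map embFst
    | some none => c.snd.map embSnd
    | some (some k) => (c.work k).map embWork

/-- Leaving a cell alone amounts to rewriting the scanned symbol; an `OracleTM`, which writes at
every step, can thus imitate optional writes. -/
theorem actOn_getD_map {C D : Type} [Inhabited C] [Inhabited D] (f : PointedMap C D)
    (a : Option C × Option Dir) (T : Tape C) :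
    OracleTM.actOn (f (a.1.getD T.head), a.2) (T.map f) = (optAct a T).map f := by
  obtain ⟨s, d⟩ := a
  have hw : (T.map f).write (f (s.getD T.head)) =
      (match s with | none => T | some s => T.write s : Tape C).map f := by
    cases s with
    | none => simp [← Tape.map_write]
    | some s => simp [Tape.map_write]
  simp only [OracleTM.actOn, optAct]
  rw [hw]
  cases d with
  | none => rfl
  | some d => simp only [OracleTM.moveHead, Tape.map_move]

theorem actOn_getD {C : Type} [Inhabited C] (a : Option C × Option Dir) (T : Tape C) :
    OracleTM.actOn (a.1.getD T.head, a.2) T = optAct a T := by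
  obtain ⟨_ | s, d⟩ := a <;> simp [OracleTM.actOn, optAct]

theorem step_emb (start : S) (δ : Program S K Γ A B) (X : Set (List Bool)) (c : Cfg S K Γ A B) :
    (toOracleTM start δ).step X (emb start δ c) = (step δ c).map (emb start δ) id := by
  have hi : (toOracleTM start δ).instr (emb start δ c).state (emb start δ c).input.head
      (emb start δ c).query.head (fun k => ((emb start δ c).work k).head) =
      toInstr c.query.head (fun k => ((emb start δ c).work k).head)
        (δ c.state c.input.head c.query.head c.fst.head c.snd.head fun k => (c.work k).head) := rfl
  unfold OracleTM.step step
  rw [hi]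
  cases h : δ c.state c.input.head c.query.head c.fst.head c.snd.head
    (fun k => (c.work k).head) with
  | inr b => rfl
  | inl act =>
    refine congrArg Sum.inl ?_
    have hq := actOn_getD act.queryAct c.query
    have h1 := actOn_getD_map embFst act.fstAct c.fst (D := Γ × A × B)
    have h2 := actOn_getD_map embSnd act.sndAct c.snd (D := Γ × A × B)
    have h3 := fun k => actOn_getD_map embWork (act.workAct k) (c.work k) (D := Γ × A × B)
    change OracleTM.Cfg.mk (M := toOracleTM start δ) act.next _
      (OracleTM.actOn (act.queryAct.1.getD c.query.head, act.queryAct.2) c.query) _ =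
      OracleTM.Cfg.mk (M := toOracleTM start δ) act.next _ (optAct act.queryAct c.query) _
    rw [hq]
    refine congrArg (OracleTM.Cfg.mk (M := toOracleTM start δ) _ _ _) (funext fun k => ?_)
    match k with
    | none => exact h1
    | some none => exact h2
    | some (some k) => exact h3 k

theorem HaltsIn.run_eq {start : S} {δ : Program S K Γ A B} (X : Set (List Bool)) {t : ℕ}
    {c : Cfg S K Γ A B} {b : Bool} (h : HaltsIn δ t c b) :
    (toOracleTM start δ).run X t (emb start δ c) = some b := by
  induction t generalizing c with
  | zero => exact h.elim
  | succ t ih =>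
    unfold HaltsIn at h
    unfold OracleTM.run
    rw [step_emb]
    cases hs : step δ c with
    | inl c' =>
      rw [hs] at h
      exact ih h
    | inr b' =>
      rw [hs] at h
      exact congrArg some h

/-- The initial configuration on input `x`. -/
def init (start : S) (x : List Bool) : Cfg S K Γ A B where
  state := start
  input := Tape.mk₁ (x.map some)
  query := Tape.mk₁ []
  fst := Tape.mk₁ []
  snd := Tape.mk₁ []
  work := fun _ => Tape.mk₁ []

theorem emb_init (start : S) (δ : Program S K Γ A B) (x : List Bool) :
    emb start δ (init start x) = (toOracleTM start δ).init x := by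
  refine congrArg (OracleTM.Cfg.mk (M := toOracleTM start δ) _ _ _) (funext fun k => ?_)
  match k with
  | none => exact Tape.map_mk₁ _ _
  | some none => exact Tape.map_mk₁ _ _
  | some (some k) => exact Tape.map_mk₁ _ _

end MixedTM

/-! ### Tapes as lists around the head -/

/-- A tape whose nonblank cells are `l` (reversed), to the left of the head, and `r`. -/
def zipper {C : Type} (l r : List C) : Tape (Option C) :=
  Tape.mk₂ (l.map some) (r.map some)

section zipper

variable {C : Type} (a b : C) (l r : List C)

@[simp] theorem head_zipper_cons : (zipper l (a :: r)).head = some a := rfl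

@[simp] theorem head_zipper_nil : (zipper l []).head = none := rfl

@[simp] theorem move_right_zipper_cons :
    (zipper l (a :: r)).move Dir.right = zipper (a :: l) r := by
  simp [zipper, Tape.mk₂]

@[simp] theorem move_left_zipper_cons :
    (zipper (a :: l) r).move Dir.left = zipper l (a :: r) := by
  simp [zipper, Tape.mk₂]

@[simp] theorem head_move_left_zipper_nil : ((zipper [] r).move Dir.left).head = none := rfl

@[simp] theorem write_zipper_cons : (zipper l (a :: r)).write (some b) = zipper l (b :: r) := by
  simp [zipper, Tape.mk₂]

@[simp] theorem write_zipper_nil : (zipper l []).write (some b) = zipper l [b] := by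
  simp [zipper, Tape.mk₂]

end zipper

/-! ### The search program -/

namespace OracleTM

/-- The information needed in order to undo a step of `M`: the scanned symbols and the moves. -/
structure Record (M : OracleTM) where
  inMove : Option Dir
  queryAct : Option Bool × Option Dir
  workAct : M.K → M.Γ × Option Dir

instance : Finite Dir :=
  Finite.of_surjective (fun b : Bool => if b then Dir.left else Dir.right) fun d => by
    cases d
    · exact ⟨true, rfl⟩
    · exact ⟨false, rfl⟩

instance (M : OracleTM) : Finite M.Record :=
  Finite.of_surjective
    (fun x : Option Dir × (Option Bool × Option Dir) × (M.K → M.Γ × Option Dir) =>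
      (⟨x.1, x.2.1, x.2.2⟩ : M.Record)) fun r => ⟨(r.1, r.2, r.3), rfl⟩

/-- The states of the search program for `M`, which simulates `M` with one finite oracle after the
other; `n` is the length of the initial part of the oracle that is kept fixed. -/
inductive SearchState (M : OracleTM) (n : ℕ) : Type
  | prepare (i : Fin n)
  | turn
  | rewindSnd
  | rewindFst
  | sim (q : M.Q)
  | scan (q : M.Q)
  | ret (q : M.Q) (ans : Bool)
  | resume (q : M.Q) (ans : Bool)
  | undo
  | restore (r : M.Record)
  | next
  | extend
  | extendFst
  | extendSnd

instance (M : OracleTM) (n : ℕ) : Finite (M.SearchState n) :=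
  Finite.of_surjective
    (fun x : Fin n ⊕ Fin 8 ⊕ M.Q ⊕ M.Q ⊕ (M.Q × Bool) ⊕ (M.Q × Bool) ⊕ M.Record =>
      match x with
      | .inl i => SearchState.prepare i
      | .inr (.inl i) => ([.turn, .rewindSnd, .rewindFst, .undo, .next, .extend, .extendFst] :
          List (M.SearchState n)).getD i .extendSnd
      | .inr (.inr (.inl q)) => .sim q
      | .inr (.inr (.inr (.inl q))) => .scan q
      | .inr (.inr (.inr (.inr (.inl q)))) => .ret q.1 q.2
      | .inr (.inr (.inr (.inr (.inr (.inl q))))) => .resume q.1 q.2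
      | .inr (.inr (.inr (.inr (.inr (.inr r))))) => .restore r) fun s => by
    cases s with
    | prepare i => exact ⟨.inl i, rfl⟩
    | turn => exact ⟨.inr (.inl 0), rfl⟩
    | rewindSnd => exact ⟨.inr (.inl 1), rfl⟩
    | rewindFst => exact ⟨.inr (.inl 2), rfl⟩
    | undo => exact ⟨.inr (.inl 3), rfl⟩
    | next => exact ⟨.inr (.inl 4), rfl⟩
    | extend => exact ⟨.inr (.inl 5), rfl⟩
    | extendFst => exact ⟨.inr (.inl 6), rfl⟩
    | extendSnd => exact ⟨.inr (.inl 7), rfl⟩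
    | sim q => exact ⟨.inr (.inr (.inl q)), rfl⟩
    | scan q => exact ⟨.inr (.inr (.inr (.inl q))), rfl⟩
    | ret q a => exact ⟨.inr (.inr (.inr (.inr (.inl (q, a))))), rfl⟩
    | resume q a => exact ⟨.inr (.inr (.inr (.inr (.inr (.inl (q, a)))))), rfl⟩
    | restore r => exact ⟨.inr (.inr (.inr (.inr (.inr (.inr r))))), rfl⟩

/-- The opposite head movement. -/
def invMove : Option Dir → Option Dir
  | none => none
  | some .left => some .right
  | some .right => some .left

/-- The search program for `M`. The first extra tape holds the finite oracle: cell `j` tells whether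
this bit is variable, and its value. The second extra tape is a clock, whose used cells hold the
records of the simulated steps. -/
def searchProgram (M : OracleTM) {n : ℕ} (w : Fin n → Bool) :
    MixedTM.Program (M.SearchState n) M.K M.Γ (Option (Bool × Bool)) (Option (Option M.Record)) :=
  fun q a b o h s =>
  match q with
  | .prepare i =>
    .inl { next := if hi : i + 1 < n then .prepare ⟨i + 1, hi⟩ else .turn
           fstAct := (some (some (false, w i)), some .right)
           sndAct := (some (some none), some .right) }
  | .turn => .inl { next := .rewindSnd, fstAct := (none, some .left), sndAct := (none, some .left) }
  | .rewindSnd =>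
    match h with
    | none => .inl { next := .rewindFst, sndAct := (none, some .right) }
    | some _ => .inl { next := .rewindSnd, sndAct := (none, some .left) }
  | .rewindFst =>
    match o with
    | none => .inl { next := .sim M.start, fstAct := (none, some .right) }
    | some _ => .inl { next := .rewindFst, fstAct := (none, some .left) }
  | .sim q =>
    match h with
    | none => .inl { next := .undo, sndAct := (none, some .left) }
    | some _ =>
      match M.instr q a b s with
      | .halt b => .inr b
      | .act q' inMove queryAct workAct =>
        .inl { next := .sim q'
               inMove := inMove
               queryAct := (some queryAct.1, queryAct.2)
               sndAct := (some (some (some ⟨inMove, (b, queryAct.2), fun k =>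
                (s k, (workAct k).2)⟩)), some .right)
               workAct := fun k => (some (workAct k).1, (workAct k).2) }
      | .query _ => .inl { next := .scan q }
  | .scan q =>
    match b, o with
    | some false, some _ =>
      .inl { next := .scan q, queryAct := (none, some .right), fstAct := (none, some .right) }
    | none, some o =>
      .inl { next := .ret q o.2, queryAct := (none, some .left), fstAct := (none, some .left) }
    | _, _ =>
      .inl { next := .ret q false, queryAct := (none, some .left), fstAct := (none, some .left) }
  | .ret q ans =>
    match o with
    | none =>
      .inl { next := .resume q ans, queryAct := (none, some .right), fstAct := (none, some .right) }
    | some _ =>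
      .inl { next := .ret q ans, queryAct := (none, some .left), fstAct := (none, some .left) }
  | .resume q ans =>
    match M.instr q a b s with
    | .query next =>
      .inl { next := .sim (next ans)
             sndAct := (some (some (some ⟨none, (b, none), fun k => (s k, none)⟩)), some .right) }
    -- Not reached after a query: the heads are back in place, so `M.instr` yields the same query
    -- again.
    | _ => .inr false
  | .undo =>
    match h with
    | none => .inl { next := .next, sndAct := (none, some .right) }
    | some none => .inr false
    | some (some r) =>
      .inl { next := .restore r
             inMove := invMove r.inMove
             queryAct := (none, invMove r.queryAct.2)
             sndAct := (some (some none), none)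
             workAct := fun k => (none, invMove (r.workAct k).2) }
  -- A step of `M` writes and then moves. Its inverse moves and then writes, which takes two steps
  -- of the program.
  | .restore r =>
    .inl { next := .undo
           queryAct := (some r.queryAct.1, none)
           sndAct := (none, some .left)
           workAct := fun k => (some (r.workAct k).1, none) }
  | .next =>
    match o with
    | none => .inl { next := .extend }
    | some (false, _) => .inl { next := .next, fstAct := (none, some .right) }
    | some (true, true) =>
      .inl { next := .next, fstAct := (some (some (true, false)), some .right) }
    | some (true, false) =>
      .inl { next := .rewindFst, fstAct := (some (some (true, true)), some .left) }
  | .extend =>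
    .inl { next := .extendFst
           fstAct := (some (some (true, false)), some .right)
           sndAct := (none, some .right) }
  | .extendFst =>
    match h with
    | none => .inl { next := .extendSnd, fstAct := (none, some .left) }
    | some _ =>
      .inl { next := .extendFst
             fstAct := (some (some (false, false)), some .right)
             sndAct := (none, some .right) }
  | .extendSnd =>
    match o with
    | some (true, _) => .inl { next := .turn, sndAct := (some (some none), some .right) }
    | _ => .inl { next := .extendSnd
                  fstAct := (none, some .left)
                  sndAct := (some (some none), some .right) }

namespace Search

variable (M : OracleTM) {n : ℕ} (w : Fin n → Bool)

/-- The configuration of the search program with the given extra tapes, in which the tapes of the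
simulated machine are those of `c`. -/
def cfgAt {M : OracleTM} {n : ℕ} (s : M.SearchState n) (c : M.Cfg) (O : Tape (Option (Bool × Bool)))
    (H : Tape (Option (Option M.Record))) :
    MixedTM.Cfg (M.SearchState n) M.K M.Γ (Option (Bool × Bool)) (Option (Option M.Record)) where
  state := s
  input := c.input
  query := c.query
  fst := O
  snd := H
  work := c.work

/-- The set of strings `0^j` where cell `j` of the list has the value `true`. -/
def cellOracle (o : List (Bool × Bool)) : Set (List Bool) :=
  {x | ∃ j m, o[j]? = some (m, true) ∧ x = List.replicate j false}

/-- The program halts within `t` steps with output `b`. -/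
abbrev Halts {M : OracleTM} {n : ℕ} (w : Fin n → Bool) (t : ℕ) (s : M.SearchState n) (c : M.Cfg)
    (O : Tape (Option (Bool × Bool))) (H : Tape (Option (Option M.Record))) (b : Bool) : Prop :=
  MixedTM.HaltsIn (M.searchProgram w) t (cfgAt s c O H) b

variable {M} {t : ℕ} {c : M.Cfg} {O : Tape (Option (Bool × Bool))}
  {H : Tape (Option (Option M.Record))} {b : Bool}

theorem halts_rewindSnd (l r : List (Option M.Record))
    (h : Halts w t .rewindFst c O (zipper [] (l.reverse ++ r)) b) :
    Halts w (t + l.length + 1) .rewindSnd c O ((zipper l r).move .left) b := by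
  induction l generalizing r with
  | nil =>
    refine h.cons ?_
    simp [MixedTM.step, cfgAt, searchProgram, MixedTM.Act.apply, MixedTM.optAct, moveHead]
  | cons a l ih =>
    refine (ih (a :: r) (by simpa using h)).cons ?_
    simp [MixedTM.step, cfgAt, searchProgram, MixedTM.Act.apply, MixedTM.optAct, moveHead]

theorem halts_rewindFst (l r : List (Bool × Bool))
    (h : Halts w t (.sim M.start) c (zipper [] (l.reverse ++ r)) H b) :
    Halts w (t + l.length + 1) .rewindFst c ((zipper l r).move .left) H b := by
  induction l generalizing r with
  | nil =>
    refine h.cons ?_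
    simp [MixedTM.step, cfgAt, searchProgram, MixedTM.Act.apply, MixedTM.optAct, moveHead]
  | cons a l ih =>
    refine (ih (a :: r) (by simpa using h)).cons ?_
    simp [MixedTM.step, cfgAt, searchProgram, MixedTM.Act.apply, MixedTM.optAct, moveHead]

theorem halts_turn (lo ro : List (Bool × Bool)) (lh rh : List (Option M.Record))
    (h : Halts w t (.sim M.start) c (zipper [] (lo.reverse ++ ro)) (zipper [] (lh.reverse ++ rh)) b) :
    Halts w (t + lo.length + lh.length + 3) .turn c (zipper lo ro) (zipper lh rh) b := by
  have := halts_rewindSnd w lh rh (halts_rewindFst w lo ro h)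
  refine (this.cons (c := cfgAt .turn c (zipper lo ro) (zipper lh rh)) ?_).mono (by omega)
  simp [MixedTM.step, cfgAt, searchProgram, MixedTM.Act.apply, MixedTM.optAct, moveHead]

end Search

end OracleTM

/-! ### Simulating `M` with one finite oracle, and undoing the simulation -/

namespace OracleTM

theorem spells_nil (T : Tape (Option Bool)) : Spells T [] ↔ T.head = none := by
  constructor
  · intro h
    simpa using h 0 (by simp)
  · intro h i hi
    obtain rfl : i = 0 := by simpa using hi
    simpa using h

theorem spells_cons (T : Tape (Option Bool)) (a : Bool) (w : List Bool) :
    Spells T (a :: w) ↔ T.head = some a ∧ Spells (T.move .right) w := by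
  constructor
  · intro h
    refine ⟨by simpa using h 0 (by simp), fun i hi => ?_⟩
    have := h (i + 1) (by simpa using hi)
    simpa using this
  · rintro ⟨h0, h⟩ i hi
    cases i with
    | zero => simpa using h0
    | succ i =>
      have := h i (by simpa using hi)
      simpa using this

namespace Search

/-- The answer found by scanning the query tape and the list in parallel. -/
def scanAnswer : List (Bool × Bool) → Tape (Option Bool) → Bool
  | [], _ => false
  | o :: r, T =>
    match T.head with
    | none => o.2
    | some true => false
    | some false => scanAnswer r (T.move .right)

theorem scanAnswer_iff (o : List (Bool × Bool)) (T : Tape (Option Bool)) :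
    scanAnswer o T = true ↔ ∃ j m, o[j]? = some (m, true) ∧ Spells T (List.replicate j false) := by
  induction o generalizing T with
  | nil => simp [scanAnswer]
  | cons a o ih =>
    rw [← Nat.or_exists_add_one]
    simp only [List.replicate_zero, spells_nil, List.replicate_succ, spells_cons,
      List.getElem?_cons_zero, List.getElem?_cons_succ, scanAnswer]
    rcases h : T.head with _ | _ | _
    · obtain ⟨m, b⟩ := a
      simp
    · simp [ih]
    · simp

theorem scanAnswer_eq (o : List (Bool × Bool)) (T : Tape (Option Bool)) :
    scanAnswer o T = answer (cellOracle o) T := by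
  rw [Bool.eq_iff_iff, scanAnswer_iff]
  simp only [answer, decide_eq_true_eq]
  constructor
  · rintro ⟨j, m, h, hs⟩
    exact ⟨_, ⟨j, m, h, rfl⟩, hs⟩
  · rintro ⟨_, ⟨j, m, h, rfl⟩, hs⟩
    exact ⟨j, m, h, hs⟩

variable {M : OracleTM} {n : ℕ} (w : Fin n → Bool)
  {t : ℕ} {c c' : M.Cfg} {O : Tape (Option (Bool × Bool))}
  {H : Tape (Option (Option M.Record))} {b : Bool}

/-- Only strings `0^j` can belong to the oracle, so the query tape and the list of cells are
traversed in parallel, until the query string ends, a `1` appears or the list is exhausted. Nothing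
is written, so walking back the same distance restores both heads; the two passes give `2 *
r.length`. -/
theorem halts_scan (q : M.Q) (l r : List (Bool × Bool)) (T : Tape (Option Bool))
    (h : Halts w t (.ret q (scanAnswer r T)) { c with query := T.move .left }
      ((zipper l r).move .left) H b) :
    Halts w (t + 2 * r.length + 1) (.scan q) { c with query := T } (zipper l r) H b := by
  induction r generalizing l T t with
  | nil =>
    refine h.cons ?_
    rcases hT : T.head with _ | _ | _ <;>
    simp [MixedTM.step, cfgAt, searchProgram, MixedTM.Act.apply, MixedTM.optAct, moveHead,
      scanAnswer, hT]
  | cons a r ih =>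
    rcases hT : T.head with _ | _ | _
    · simp only [scanAnswer, hT] at h
      refine (h.cons (c := cfgAt (.scan q) { c with query := T } (zipper l (a :: r)) H) ?_).mono
        (by omega)
      simp [MixedTM.step, cfgAt, searchProgram, MixedTM.Act.apply, MixedTM.optAct, moveHead, hT]
    · simp only [scanAnswer, hT] at h
      have h' : Halts w (t + 1) (.ret q (scanAnswer r (T.move .right)))
          { c with query := (T.move .right).move .left } ((zipper (a :: l) r).move .left) H b := by
        refine h.cons ?_
        simp [MixedTM.step, cfgAt, searchProgram, MixedTM.Act.apply, MixedTM.optAct, moveHead]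
      refine ((ih _ _ h').cons
        (c := cfgAt (.scan q) { c with query := T } (zipper l (a :: r)) H) ?_).mono
        (by simp only [List.length_cons]; omega)
      simp [MixedTM.step, cfgAt, searchProgram, MixedTM.Act.apply, MixedTM.optAct, moveHead, hT]
    · simp only [scanAnswer, hT] at h
      refine (h.cons (c := cfgAt (.scan q) { c with query := T } (zipper l (a :: r)) H) ?_).mono
        (by omega)
      simp [MixedTM.step, cfgAt, searchProgram, MixedTM.Act.apply, MixedTM.optAct, moveHead, hT]

/-- The record of the step that `M` makes from the configuration `c`. -/
def recordOf (c : M.Cfg) : M.Record :=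
  match M.instr c.state c.input.head c.query.head (fun k => (c.work k).head) with
  | .act _ inMove queryAct workAct =>
    ⟨inMove, (c.query.head, queryAct.2), fun k => ((c.work k).head, (workAct k).2)⟩
  | _ => ⟨none, (c.query.head, none), fun k => ((c.work k).head, none)⟩

theorem halts_sim_step {o : List (Bool × Bool)} (x : Option M.Record) (l r : List (Option M.Record))
    (hs : M.step (cellOracle o) c = .inl c')
    (h : Halts w t (.sim c'.state) c' (zipper [] o) (zipper (some (recordOf c) :: l) r) b) :
    Halts w (t + 2 * o.length + 4) (.sim c.state) c (zipper [] o) (zipper l (x :: r)) b := by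
  unfold step at hs
  unfold recordOf at h
  rcases hi : M.instr c.state c.input.head c.query.head (fun k => (c.work k).head) with
    b' | ⟨q', im, qa, wa⟩ | next
  · simp [hi] at hs
  · simp only [hi, Sum.inl.injEq] at hs h
    subst hs
    refine (h.cons (c := cfgAt (.sim c.state) c (zipper [] o) (zipper l (x :: r))) ?_).mono
      (by omega)
    simp only [MixedTM.step, cfgAt, searchProgram, head_zipper_cons, hi]
    simp [MixedTM.Act.apply, MixedTM.optAct, moveHead, actOn]
  · simp only [hi, Sum.inl.injEq] at hs h
    subst hs
    have h1 : Halts w (t + 1) (.resume c.state (answer (cellOracle o) c.query)) c (zipper [] o)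
        (zipper l (x :: r)) b := by
      refine h.cons ?_
      simp only [MixedTM.step, cfgAt, searchProgram, hi]
      simp [MixedTM.Act.apply, MixedTM.optAct, moveHead]
    have h2 : Halts w (t + 2) (.ret c.state (answer (cellOracle o) c.query))
        { c with query := c.query.move .left } ((zipper [] o).move .left)
        (zipper l (x :: r)) b := by
      refine h1.cons ?_
      simp [MixedTM.step, cfgAt, searchProgram, MixedTM.Act.apply, MixedTM.optAct, moveHead]
    rw [← scanAnswer_eq] at h2
    refine ((halts_scan w c.state [] o c.query h2).cons
      (c := cfgAt (.sim c.state) c (zipper [] o) (zipper l (x :: r))) ?_).mono (by omega)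
    simp only [MixedTM.step, cfgAt, searchProgram, head_zipper_cons, hi]
    simp [MixedTM.Act.apply, MixedTM.optAct, moveHead]

theorem moveHead_invMove {C : Type} [Inhabited C] (d : Option Dir) (T : Tape C) :
    moveHead (invMove d) (moveHead d T) = T := by
  rcases d with _ | _ | _ <;> simp [moveHead, invMove]

theorem write_head_moveHead_actOn {C : Type} [Inhabited C] (a : C × Option Dir) (T : Tape C) :
    (moveHead (invMove a.2) (actOn a T)).write T.head = T := by
  rw [actOn, moveHead_invMove]
  rfl

theorem halts_undo_step {X : Set (List Bool)} (l r : List (Option M.Record))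
    (hs : M.step X c = .inl c')
    (h : Halts w t .undo c O ((zipper l (none :: r)).move .left) b) :
    Halts w (t + 2) .undo c' O (zipper l (some (recordOf c) :: r)) b := by
  unfold step at hs
  have h1 : Halts w (t + 1) (.restore (recordOf c))
      { c' with
        input := moveHead (invMove (recordOf c).inMove) c'.input
        query := moveHead (invMove (recordOf c).queryAct.2) c'.query
        work := fun k => moveHead (invMove ((recordOf c).workAct k).2) (c'.work k) }
      O (zipper l (none :: r)) b := by
    refine h.cons ?_
    unfold recordOf
    rcases hi : M.instr c.state c.input.head c.query.head (fun k => (c.work k).head) with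
      b' | ⟨q', im, qa, wa⟩ | next
    · simp [hi] at hs
    · simp only [hi, Sum.inl.injEq] at hs
      subst hs
      simp [MixedTM.step, cfgAt, searchProgram, MixedTM.Act.apply, MixedTM.optAct,
        moveHead_invMove, write_head_moveHead_actOn]
      simp [moveHead]
    · simp only [hi, Sum.inl.injEq] at hs
      subst hs
      simp [MixedTM.step, cfgAt, searchProgram, MixedTM.Act.apply, MixedTM.optAct, moveHead, invMove]
  refine h1.cons ?_
  simp [MixedTM.step, cfgAt, searchProgram, MixedTM.Act.apply, MixedTM.optAct, moveHead]

/-- The clock: if the simulated machine halts within `k` steps, then so does the search program,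
with the same output; otherwise, the simulated steps are undone. -/
theorem halts_sim {o : List (Bool × Bool)} (k : ℕ) (l : List (Option M.Record))
    (hrun : ∀ b', M.run (cellOracle o) k c = some b' → b' = b)
    (h : M.run (cellOracle o) k c = none →
      Halts w t .undo c (zipper [] o) ((zipper l (List.replicate k none)).move .left) b) :
    Halts w (t + k * (2 * o.length + 6) + 1) (.sim c.state) c (zipper [] o)
      (zipper l (List.replicate k none)) b := by
  induction k generalizing c l t with
  | zero =>
    refine ((h rfl).cons ?_).mono (by omega)
    simp [MixedTM.step, cfgAt, searchProgram, MixedTM.Act.apply, MixedTM.optAct, moveHead]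
  | succ k ih =>
    simp only [run] at hrun h
    rcases hs : M.step (cellOracle o) c with c' | b'
    · simp only [hs] at hrun h
      -- The two additional steps pay for undoing this simulated step.
      refine (halts_sim_step w none l _ hs (ih (t := t + 2) _ hrun fun hk => ?_)).mono ?_
      · have := halts_undo_step w l (List.replicate k none) hs (h hk)
        simpa using this
      · ring_nf
        omega
    · simp only [hs] at hrun
      obtain rfl := hrun b' rfl
      refine (MixedTM.HaltsIn.of_halt ?_).mono (Nat.le_add_left 1 _)
      unfold step at hs
      rcases hi : M.instr c.state c.input.head c.query.head (fun k => (c.work k).head) with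
        b'' | ⟨q', im, qa, wa⟩ | next
      · simp only [hi, Sum.inr.injEq] at hs
        subst hs
        simp only [MixedTM.step, cfgAt, searchProgram, List.replicate_succ, head_zipper_cons, hi]
        rfl
      · simp [hi] at hs
      · simp [hi] at hs

end Search
end OracleTM

/-! ### Enumerating the oracles of one level with a binary counter -/

namespace OracleTM.Search

/-- Increment the binary counter formed by the variable bits, the least significant bit first. The
first component of the result tells whether there is an overflow. -/
def incr : List (Bool × Bool) → Bool × List (Bool × Bool)
  | [] => (true, [])
  | (false, v) :: r => ((incr r).1, (false, v) :: (incr r).2)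
  | (true, true) :: r => ((incr r).1, (true, false) :: (incr r).2)
  | (true, false) :: r => (false, (true, true) :: r)

/-- The value of the binary counter formed by the variable bits. -/
def value : List (Bool × Bool) → ℕ
  | [] => 0
  | (false, _) :: r => value r
  | (true, v) :: r => v.toNat + 2 * value r

/-- Set all variable bits to `false`. -/
def shape (o : List (Bool × Bool)) : List (Bool × Bool) :=
  o.map fun p => (p.1, !p.1 && p.2)

/-- The number of variable bits. -/
def numVars (o : List (Bool × Bool)) : ℕ :=
  o.countP fun p => p.1

/-- `shape` is the invariant of the enumeration: it retains which cells are variable and the values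
of the fixed ones. Together with `value` it determines the list (`eq_of_value_eq`). -/
theorem shape_incr (o : List (Bool × Bool)) : shape (incr o).2 = shape o := by
  induction o with
  | nil => rfl
  | cons a o ih =>
    rcases a with ⟨_ | _, _ | _⟩
    · simpa [incr, shape] using ih
    · simpa [incr, shape] using ih
    · simp [incr, shape]
    · simpa [incr, shape] using ih

theorem length_eq_of_shape_eq {o s : List (Bool × Bool)} (h : shape o = shape s) :
    o.length = s.length := by
  simpa [shape] using congrArg List.length h

theorem numVars_shape (o : List (Bool × Bool)) : numVars (shape o) = numVars o := by
  simp [numVars, shape, List.countP_map, Function.comp_def]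

theorem value_shape (o : List (Bool × Bool)) : value (shape o) = 0 := by
  induction o with
  | nil => rfl
  | cons a o ih => rcases a with ⟨_ | _, _ | _⟩ <;> simpa [value, shape] using ih

theorem value_incr_of_no_overflow {o : List (Bool × Bool)} (h : (incr o).1 = false) :
    value (incr o).2 = value o + 1 := by
  induction o with
  | nil => simp [incr] at h
  | cons a o ih =>
    rcases a with ⟨_ | _, _ | _⟩ <;> simp only [incr] at h <;> simp [incr, value] <;>
      first | omega | (have := ih h; omega)

theorem value_incr_of_overflow {o : List (Bool × Bool)} (h : (incr o).1 = true) :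
    value (incr o).2 = 0 := by
  induction o with
  | nil => rfl
  | cons a o ih =>
    rcases a with ⟨_ | _, _ | _⟩ <;> simp only [incr] at h <;> simp [incr, value] <;>
      first | exact ih h | simp at h

theorem value_add_one_of_overflow {o : List (Bool × Bool)} (h : (incr o).1 = true) :
    value o + 1 = 2 ^ numVars o := by
  induction o with
  | nil => rfl
  | cons a o ih =>
    rcases a with ⟨_ | _, _ | _⟩ <;> simp only [incr] at h <;>
      first
        | (simp at h)
        | (have := ih h; simp [value, numVars, pow_succ] at this ⊢; omega)

theorem value_lt (o : List (Bool × Bool)) : value o < 2 ^ numVars o := by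
  induction o with
  | nil => simp [value, numVars]
  | cons a o ih =>
    rcases a with ⟨_ | _, _ | _⟩ <;> simp [value, numVars, pow_succ] at ih ⊢ <;> omega

theorem eq_of_value_eq {o o' : List (Bool × Bool)} (hs : shape o = shape o')
    (hv : value o = value o') : o = o' := by
  induction o generalizing o' with
  | nil =>
    cases o' with
    | nil => rfl
    | cons a o' => simp [shape] at hs
  | cons a o ih =>
    cases o' with
    | nil => simp [shape] at hs
    | cons a' o' =>
      simp only [shape, List.map_cons, List.cons.injEq] at hs
      obtain ⟨h1, h2⟩ := hs
      rcases a with ⟨_ | _, _ | _⟩ <;> rcases a' with ⟨_ | _, _ | _⟩ <;>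
        simp [value] at h1 hv <;> first
          | (rw [ih h2 (by omega)]; done)
          | (exfalso; omega)

variable {M : OracleTM} {n : ℕ} (w : Fin n → Bool)
  {t : ℕ} {c : M.Cfg} {O : Tape (Option (Bool × Bool))}
  {H : Tape (Option (Option M.Record))} {b : Bool}

/-- Without overflow, the carry stops at some cell and the head rewinds for a new simulation. With
overflow, it ends just past the last cell, which is where `extend` starts to write. -/
theorem halts_next (l r : List (Bool × Bool))
    (h0 : (incr r).1 = true → Halts w t .extend c (zipper ((incr r).2.reverse ++ l) []) H b)
    (h1 : (incr r).1 = false →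
      Halts w t (.sim M.start) c (zipper [] (l.reverse ++ (incr r).2)) H b) :
    Halts w (t + 2 * r.length + l.length + 2) .next c (zipper l r) H b := by
  induction r generalizing l with
  | nil =>
    refine ((h0 rfl).cons (c := cfgAt .next c (zipper l []) H) ?_).mono
      (by simp only [List.length_nil]; omega)
    simp [MixedTM.step, cfgAt, searchProgram, MixedTM.Act.apply, MixedTM.optAct, moveHead, incr]
  | cons a r ih =>
    rcases a with ⟨_ | _, v⟩
    · refine ((ih ((false, v) :: l) (fun h => by simpa [incr] using h0 h)
        (fun h => by simpa [incr] using h1 h)).cons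
        (c := cfgAt .next c (zipper l ((false, v) :: r)) H) ?_).mono
        (by simp only [List.length_cons]; omega)
      simp [MixedTM.step, cfgAt, searchProgram, MixedTM.Act.apply, MixedTM.optAct, moveHead]
    · rcases v with _ | _
      · refine ((halts_rewindFst w l ((true, true) :: r) (h1 rfl)).cons
          (c := cfgAt .next c (zipper l ((true, false) :: r)) H) ?_).mono
          (by simp only [List.length_cons]; omega)
        simp [MixedTM.step, cfgAt, searchProgram, MixedTM.Act.apply, MixedTM.optAct, moveHead]
      · refine ((ih ((true, false) :: l) (fun h => by simpa [incr] using h0 h)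
          (fun h => by simpa [incr] using h1 h)).cons
          (c := cfgAt .next c (zipper l ((true, true) :: r)) H) ?_).mono
          (by simp only [List.length_cons]; omega)
        simp [MixedTM.step, cfgAt, searchProgram, MixedTM.Act.apply, MixedTM.optAct, moveHead]

theorem halts_extendFst (k : ℕ) (lo : List (Bool × Bool)) (lh : List (Option M.Record))
    (h : Halts w t .extendFst c (zipper (List.replicate k (false, false) ++ lo) [])
      (zipper (List.replicate k none ++ lh) []) b) :
    Halts w (t + k) .extendFst c (zipper lo []) (zipper lh (List.replicate k none)) b := by
  induction k generalizing lo lh with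
  | zero => exact h
  | succ k ih =>
    refine (ih ((false, false) :: lo) (none :: lh) ?_).cons ?_
    · simpa only [List.replicate_succ', List.append_assoc, List.singleton_append] using h
    · simp [MixedTM.step, cfgAt, searchProgram, MixedTM.Act.apply, MixedTM.optAct, moveHead,
        List.replicate_succ]

theorem halts_extendSnd (k : ℕ) (v : Bool) (l r : List (Bool × Bool)) (lh : List (Option M.Record))
    (h : Halts w t .turn c (zipper l ((true, v) :: (List.replicate k (false, false) ++ r)))
      (zipper (List.replicate (k + 1) none ++ lh) []) b) :
    Halts w (t + k + 1) .extendSnd c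
      ((zipper (List.replicate k (false, false) ++ (true, v) :: l) r).move .left)
      (zipper lh []) b := by
  induction k generalizing r lh with
  | zero =>
    refine h.cons ?_
    simp [MixedTM.step, cfgAt, searchProgram, MixedTM.Act.apply, MixedTM.optAct, moveHead]
  | succ k ih =>
    refine ((ih ((false, false) :: r) (none :: lh) ?_).cons
      (c := cfgAt .extendSnd c
      ((zipper (List.replicate (k + 1) (false, false) ++ (true, v) :: l) r).move .left)
      (zipper lh [])) ?_).mono (by omega)
    · rw [List.replicate_succ' (n := k), List.replicate_succ' (n := k + 1)] at h
      simpa only [List.append_assoc, List.singleton_append] using h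
    · simp [MixedTM.step, cfgAt, searchProgram, MixedTM.Act.apply, MixedTM.optAct, moveHead,
        List.replicate_succ]

/-- The clock measures the current length `k + 1`: traversing it appends as many oracle cells, of
which only the first is variable, and walking back over these appends as many clock cells. Both
lengths double. -/
theorem halts_extend (s : List (Bool × Bool)) (k : ℕ)
    (h : Halts w t (.sim M.start) c
      (zipper [] (s ++ (true, false) :: List.replicate k (false, false)))
      (zipper [] (List.replicate (2 * (k + 1)) none)) b) :
    Halts w (t + s.length + 4 * k + 8) .extend c (zipper s.reverse [])
      (zipper [] (List.replicate (k + 1) none)) b := by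
  have h1 := halts_turn w s.reverse ((true, false) :: List.replicate k (false, false))
    (List.replicate (2 * (k + 1)) none) [] (c := c) (t := t) (b := b) (by simpa using h)
  rw [List.length_reverse, List.length_replicate] at h1
  have h2 := halts_extendSnd w k false s.reverse [] (List.replicate (k + 1) none) (c := c) (b := b)
    (t := t + s.length + 2 * (k + 1) + 3)
    (by simpa [two_mul, ← List.replicate_add] using h1)
  have h3 : Halts w (t + s.length + 2 * (k + 1) + 3 + k + 1 + 1) .extendFst c
      (zipper (List.replicate k (false, false) ++ (true, false) :: s.reverse) [])
      (zipper (List.replicate k none ++ [none]) []) b := h2.cons (by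
    simp [MixedTM.step, cfgAt, searchProgram, MixedTM.Act.apply, MixedTM.optAct, moveHead,
      ← List.replicate_succ'])
  refine ((halts_extendFst w k _ _ h3).cons
    (c := cfgAt .extend c (zipper s.reverse []) (zipper [] (List.replicate (k + 1) none))) ?_).mono
    (by omega)
  simp [MixedTM.step, cfgAt, searchProgram, MixedTM.Act.apply, MixedTM.optAct, moveHead,
    List.replicate_succ]

theorem halts_prepare
    (h : Halts w t .turn c (zipper (List.ofFn fun i => (false, w i)).reverse [])
      (zipper (List.replicate n none) []) b) (k : ℕ) (i : Fin n) (hk : i + k + 1 = n) :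
    Halts w (t + k + 1) (.prepare i) c
      (zipper ((List.ofFn fun i => (false, w i)).take i).reverse [])
      (zipper (List.replicate i none) []) b := by
  have htake (i : Fin n) : ((List.ofFn fun i => (false, w i)).take (i + 1)).reverse =
      (false, w i) :: ((List.ofFn fun i => (false, w i)).take i).reverse := by
    rw [List.take_add_one]
    simp
  induction k generalizing i with
  | zero =>
    refine h.cons ?_
    have htake := htake i
    rw [List.take_of_length_le (by simp; omega)] at htake
    have hi : ¬ (i : ℕ) + 1 < n := by omega
    have hn : List.replicate n (none : Option M.Record) = none :: List.replicate i none := by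
      rw [← List.replicate_succ]
      congr 1
      omega
    simp [MixedTM.step, cfgAt, searchProgram, MixedTM.Act.apply, MixedTM.optAct, moveHead,
      hn, htake, hi]
  | succ k ih =>
    have hi : (i : ℕ) + 1 < n := by omega
    refine ((ih ⟨i + 1, hi⟩ (by simp; omega)).cons
      (c := cfgAt (.prepare i) c (zipper ((List.ofFn fun i => (false, w i)).take i).reverse [])
      (zipper (List.replicate i none) [])) ?_).mono (by omega)
    simp [MixedTM.step, cfgAt, searchProgram, MixedTM.Act.apply, MixedTM.optAct, moveHead,
        List.replicate_succ, htake, hi]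

/-- A bound on the time for the simulation of one oracle with `m` cells for `m` steps. -/
def simTime (m : ℕ) : ℕ := m * (2 * m + 6) + 2 * m + 4

variable {x : List Bool} {s : List (Bool × Bool)}

/-- One round: simulate, undo, increment. In `simTime m`, each of the `m` steps costs `2 * m + 4` to
simulate and `2` to undo; the remaining `2 * m + 4` cover the end of the clock and the counter. -/
theorem halts_sim_init {o : List (Bool × Bool)} {m : ℕ} (ho : o.length = m)
    (hrun : ∀ b', M.run (cellOracle o) m (M.init x) = some b' → b' = b)
    (h0 : M.run (cellOracle o) m (M.init x) = none → (incr o).1 = true →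
      Halts w t .extend (M.init x) (zipper (incr o).2.reverse [])
        (zipper [] (List.replicate m none)) b)
    (h1 : M.run (cellOracle o) m (M.init x) = none → (incr o).1 = false →
      Halts w t (.sim M.start) (M.init x) (zipper [] (incr o).2)
        (zipper [] (List.replicate m none)) b) :
    Halts w (t + simTime m) (.sim M.start) (M.init x) (zipper [] o)
      (zipper [] (List.replicate m none)) b := by
  refine (halts_sim w (c := M.init x) m [] (t := t + 2 * m + 3) hrun fun hn => ?_).mono ?_
  · have := halts_next w [] o (fun h => by simpa using h0 hn h) (fun h => by simpa using h1 hn h)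
    refine (this.cons (c := cfgAt .undo _ _ _) ?_).mono
      (by simp only [List.length_nil]; omega)
    simp [MixedTM.step, cfgAt, searchProgram, MixedTM.Act.apply, MixedTM.optAct, moveHead]
  · rw [ho, simTime]
    omega

/-- Induction on the number `d` of increments left before the overflow. Simulations that halt
earlier are harmless, since by `hrun` they output `b`. -/
theorem halts_level {m : ℕ} (hs : shape s = s) (hm : s.length = m)
    (hrun : ∀ o, shape o = s → ∀ b', M.run (cellOracle o) m (M.init x) = some b' → b' = b)
    (h : Halts w t .extend (M.init x) (zipper s.reverse []) (zipper [] (List.replicate m none)) b)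
    (d : ℕ) (o : List (Bool × Bool)) (ho : shape o = s) (hd : value o + d + 1 = 2 ^ numVars s) :
    Halts w (t + (d + 1) * simTime m) (.sim M.start) (M.init x) (zipper [] o)
      (zipper [] (List.replicate m none)) b := by
  induction d generalizing o with
  | zero =>
    have hlen : o.length = m := by rw [← hm]; exact length_eq_of_shape_eq (ho.trans hs.symm)
    rw [zero_add, one_mul]
    refine halts_sim_init w hlen (hrun o ho) (fun _ hc => ?_) (fun _ hc => ?_)
    · rwa [eq_of_value_eq (o := (incr o).2) (o' := s) (by rw [shape_incr, ho, hs])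
        (by rw [value_incr_of_overflow hc, ← hs, value_shape])]
    · exfalso
      have h1 := value_incr_of_no_overflow hc
      have h2 := value_lt (incr o).2
      rw [← numVars_shape, shape_incr, ho] at h2
      omega
  | succ d ih =>
    have hlen : o.length = m := by rw [← hm]; exact length_eq_of_shape_eq (ho.trans hs.symm)
    rw [add_mul (d + 1), one_mul, ← add_assoc]
    refine halts_sim_init w hlen (hrun o ho) (fun _ hc => ?_) (fun _ hc => ?_)
    · exfalso
      have := value_add_one_of_overflow hc
      rw [← numVars_shape, ho] at this
      omega
    · refine ih _ (by rw [shape_incr, ho]) ?_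
      rw [value_incr_of_no_overflow hc]
      omega

/-- The counter reaches `o'` after `d` increments, unless an earlier oracle halts, with the same
output. No overflow intervenes, because `value o'` is below `2 ^ numVars`. -/
theorem halts_last_level {m : ℕ} (hs : shape s = s) (hm : s.length = m)
    (hrun : ∀ o, shape o = s → ∀ b', M.run (cellOracle o) m (M.init x) = some b' → b' = b)
    {o' : List (Bool × Bool)} (ho' : shape o' = s)
    (h : M.run (cellOracle o') m (M.init x) = some b)
    (d : ℕ) (o : List (Bool × Bool)) (ho : shape o = s) (hd : value o + d = value o') :
    Halts w ((d + 1) * simTime m) (.sim M.start) (M.init x) (zipper [] o)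
      (zipper [] (List.replicate m none)) b := by
  induction d generalizing o with
  | zero =>
    have hlen : o.length = m := by rw [← hm]; exact length_eq_of_shape_eq (ho.trans hs.symm)
    obtain rfl := eq_of_value_eq (ho.trans ho'.symm) hd
    refine (halts_sim_init w (t := 0) hlen (hrun o ho) (fun hn _ => ?_) (fun hn _ => ?_)).mono
      (by omega) <;> simp [hn] at h
  | succ d ih =>
    have hlen : o.length = m := by rw [← hm]; exact length_eq_of_shape_eq (ho.trans hs.symm)
    rw [add_mul (d + 1), one_mul]
    refine halts_sim_init w hlen (hrun o ho) (fun _ hc => ?_) (fun _ hc => ?_)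
    · exfalso
      have h1 := value_add_one_of_overflow hc
      have h2 := value_lt o'
      rw [← numVars_shape, ho] at h1
      rw [← numVars_shape, ho'] at h2
      omega
    · refine ih _ (by rw [shape_incr, ho]) ?_
      rw [value_incr_of_no_overflow hc]
      omega

end OracleTM.Search

/-! ### Bounded use of the oracle -/

namespace OracleTM

/-- Runs with two oracles agree if the oracles agree on the strings that are short enough to be
written on the query tape. -/
theorem run_congr {M : OracleTM} {X Y : Set (List Bool)} (t s : ℕ) (c : M.Cfg)
    (hc : ∀ i : ℤ, s < i → c.query.nth i = none)
    (hXY : ∀ x : List Bool, x.length ≤ s + t → (x ∈ X ↔ x ∈ Y)) : M.run X t c = M.run Y t c := by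
  induction t generalizing s c with
  | zero => rfl
  | succ t ih =>
    have hans : answer X c.query = answer Y c.query := by
      have : ∀ w, (w ∈ X ∧ Spells c.query w) ↔ (w ∈ Y ∧ Spells c.query w) := by
        refine fun w => and_congr_left fun hw => hXY w ?_
        by_contra! hlen
        have h1 := hw (s + 1) (by omega)
        rw [hc _ (by push_cast; omega), List.getElem?_eq_getElem (by omega)] at h1
        simp at h1
      simp only [answer, decide_eq_decide]
      exact exists_congr this
    have hstep : M.step X c = M.step Y c := by
      simp only [step, hans]
    simp only [run]
    rw [hstep]
    rcases hs : M.step Y c with c' | b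
    · refine ih (s + 1) c' (fun i hi => ?_) (fun x hx => hXY x (by omega))
      push_cast at hi
      unfold step at hs
      rcases hi : M.instr c.state c.input.head c.query.head (fun k => (c.work k).head) with
        b' | ⟨q', im, ⟨a, d⟩, wa⟩ | next
      · simp [hi] at hs
      · simp only [hi, Sum.inl.injEq] at hs
        subst hs
        rcases d with _ | _ | _
        · simp only [actOn, moveHead]
          rw [Tape.write_nth, if_neg (by omega), hc _ (by omega)]
        · simp only [actOn, moveHead]
          rw [Tape.move_left_nth, Tape.write_nth, if_neg (by omega), hc _ (by omega)]
        · simp only [actOn, moveHead]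
          rw [Tape.move_right_nth, Tape.write_nth, if_neg (by omega), hc _ (by omega)]
      · simp only [hi, Sum.inl.injEq] at hs
        subst hs
        exact hc _ (by omega)
    · rfl

theorem run_init_congr {M : OracleTM} {X Y : Set (List Bool)} (t : ℕ) (x : List Bool)
    (hXY : ∀ x : List Bool, x.length ≤ t → (x ∈ X ↔ x ∈ Y)) :
    M.run X t (M.init x) = M.run Y t (M.init x) := by
  refine run_congr t 0 _ (fun i hi => ?_) (by simpa using hXY)
  obtain ⟨k, rfl⟩ := Int.eq_ofNat_of_zero_le (by omega : 0 ≤ i)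
  simp [init, Tape.mk₁, Tape.mk₂]
  rfl

theorem run_mono {M : OracleTM} {X : Set (List Bool)} {t t' : ℕ} {c : M.Cfg} {b : Bool}
    (h : M.run X t c = some b) (ht : t ≤ t') : M.run X t' c = some b := by
  induction t generalizing t' c with
  | zero => simp [run] at h
  | succ t ih =>
    obtain ⟨t', rfl⟩ : ∃ s, t' = s + 1 := ⟨t' - 1, by omega⟩
    simp only [run] at h ⊢
    cases hs : M.step X c with
    | inl c' =>
      rw [hs] at h
      exact ih h (by omega)
    | inr b' =>
      rw [hs] at h
      exact h

end OracleTM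

/-! ### Sparse oracles and their lists of cells -/

/-- The set of strings `0^(2^k)` such that the `k`-th bit is `true`. -/
def seqOracle (B : ℕ → Bool) : Set (List Bool) :=
  {x | ∃ k, B k = true ∧ x = List.replicate (2 ^ k) false}

/-- The finite set of strings `0^(2^k)` such that the `k`-th bit of the string is `true`. -/
def bitOracle (σ : List Bool) : Set (List Bool) := seqOracle fun k => σ.getD k false

namespace OracleTM.Search

open Classical in
/-- The finite oracle given by `B`, as a list of `2 ^ m` cells in which the bits from `l` on are
variable. -/
noncomputable def cells (l : ℕ) (B : ℕ → Bool) (m : ℕ) : List (Bool × Bool) :=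
  (List.range (2 ^ m)).map fun j =>
    (decide (2 ^ l ≤ j ∧ ∃ k, j = 2 ^ k), decide (∃ k, B k = true ∧ j = 2 ^ k))

variable {l m : ℕ} {B B' : ℕ → Bool}

theorem length_cells : (cells l B m).length = 2 ^ m := by simp [cells]

theorem shape_cells (h : ∀ k < l, B k = B' k) (h' : ∀ k, l ≤ k → B' k = false) :
    shape (cells l B m) = cells l B' m := by
  simp only [shape, cells, List.map_map]
  refine List.map_congr_left fun j _ => ?_
  simp only [Function.comp_apply, Prod.mk.injEq, true_and]
  rw [Bool.eq_iff_iff]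
  simp only [Bool.and_eq_true, Bool.not_eq_true', decide_eq_false_iff_not, decide_eq_true_eq]
  constructor
  · rintro ⟨h1, k, hk, rfl⟩
    have hkl : k < l := by
      by_contra! hkl
      exact h1 ⟨Nat.pow_le_pow_right (by norm_num) hkl, k, rfl⟩
    exact ⟨k, by rw [← h k hkl, hk], rfl⟩
  · rintro ⟨k, hk, rfl⟩
    have hkl : k < l := by
      by_contra! hkl
      simp [h' k hkl] at hk
    refine ⟨fun ⟨h1, _⟩ => ?_, k, by rw [h k hkl, hk], rfl⟩
    exact absurd ((Nat.pow_le_pow_iff_right (by norm_num)).1 h1) (by omega)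

/-- The only power of two in `[2^m, 2^(m+1))` is `2^m`, so the new block is exactly what `extend`
appends. -/
theorem cells_succ (h' : ∀ k, l ≤ k → B' k = false) (hm : l ≤ m) :
    cells l B' (m + 1) =
      cells l B' m ++ (true, false) :: List.replicate (2 ^ m - 1) (false, false) := by
  have hpos : 0 < 2 ^ m := by positivity
  have hlm : 2 ^ l ≤ 2 ^ m := Nat.pow_le_pow_right (by norm_num) hm
  refine List.ext_getElem (by simp [length_cells, pow_succ]; omega) fun j h1 h2 => ?_
  rw [length_cells, pow_succ] at h1
  rcases lt_trichotomy j (2 ^ m) with h | rfl | h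
  · rw [List.getElem_append_left (by rwa [length_cells])]
    simp [cells]
  · rw [List.getElem_append_right (by rw [length_cells])]
    simp only [cells, List.getElem_map, List.getElem_range, List.length_map, List.length_range,
      Nat.sub_self, List.getElem_cons_zero, Prod.mk.injEq, decide_eq_true_eq,
      decide_eq_false_iff_not]
    refine ⟨⟨hlm, m, rfl⟩, ?_⟩
    rintro ⟨k, hk, he⟩
    obtain rfl := Nat.pow_right_injective (le_refl 2) he
    simp [h' _ hm] at hk
  · rw [List.getElem_append_right (by rw [length_cells]; omega)]
    have hne : ∀ k, j ≠ 2 ^ k := by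
      rintro k rfl
      have h3 := (Nat.pow_lt_pow_iff_right (by norm_num : 1 < 2)).1 h
      have h4 : 2 ^ k < 2 ^ (m + 1) := by rw [pow_succ]; exact h1
      have h5 := (Nat.pow_lt_pow_iff_right (by norm_num : 1 < 2)).1 h4
      omega
    obtain ⟨i, hi⟩ : ∃ i, j - (cells l B' m).length = i + 1 :=
      ⟨j - 2 ^ m - 1, by rw [length_cells]; omega⟩
    simp only [hi, List.getElem_cons_succ, List.getElem_replicate]
    simp [cells, hne]

/-- This is where sparseness pays off: `2^m` cells carry at most `m` variable bits, so a level has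
at most as many oracles as cells. -/
theorem numVars_cells_le (h' : ∀ k, l ≤ k → B' k = false) (hm : l ≤ m) :
    numVars (cells l B' m) ≤ m := by
  induction m, hm using Nat.le_induction with
  | base =>
    have : numVars (cells l B' l) = 0 := by
      rw [numVars, List.countP_eq_zero]
      simp only [cells, List.mem_map, List.mem_range, forall_exists_index, and_imp]
      rintro _ j hj rfl
      simp only [decide_eq_true_eq]
      omega
    omega
  | succ m hm ih =>
    rw [cells_succ h' hm]
    simp only [numVars, List.countP_append, List.countP_cons, List.countP_replicate] at ih ⊢
    simpa using ih

theorem cellOracle_cells : cellOracle (cells l B m) = seqOracle fun k => decide (k < m) && B k := by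
  classical
  ext x
  simp only [cellOracle, seqOracle, Set.mem_ofPred_eq, Bool.and_eq_true, decide_eq_true_eq, cells,
    List.getElem?_map]
  constructor
  · rintro ⟨j, v, hj, rfl⟩
    obtain ⟨i, hi, he⟩ := Option.map_eq_some_iff.1 hj
    obtain ⟨hlt, rfl⟩ := List.getElem?_eq_some_iff.1 hi
    simp only [List.getElem_range, Prod.mk.injEq, decide_eq_true_eq] at he
    obtain ⟨k, hk, rfl⟩ := he.2
    simp only [List.length_range] at hlt
    exact ⟨k, ⟨(Nat.pow_lt_pow_iff_right (by norm_num : 1 < 2)).1 hlt, hk⟩, rfl⟩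
  · rintro ⟨k, ⟨hk, hB⟩, rfl⟩
    refine ⟨2 ^ k, decide (2 ^ l ≤ 2 ^ k ∧ ∃ i, 2 ^ k = 2 ^ i), ?_, rfl⟩
    rw [List.getElem?_range (Nat.pow_lt_pow_right Nat.one_lt_two hk)]
    simp only [Option.map_some, Option.some.injEq, Prod.mk.injEq, true_and, decide_eq_true_eq]
    exact ⟨k, hB, rfl⟩

/-- Cells not at powers of two are fixed to `false`, so every list met by the enumeration comes from
a sequence, read off at the cells `2 ^ k`. Soundness for the extensions of `σ` thus covers every
simulation. -/
theorem eq_cells_of_shape_eq {o : List (Bool × Bool)}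
    (ho : shape o = cells l B' m) :
    ∃ B, (∀ k < l, k < m → B k = B' k) ∧ o = cells l B m := by
  classical
  have hlen : o.length = 2 ^ m := by
    rw [← length_cells (l := l) (B := B'), ← ho]
    simp [shape]
  have hget (j : ℕ) (hj : j < o.length) : ((o[j].1, !o[j].1 && o[j].2) : Bool × Bool) =
      (cells l B' m)[j]'(by rw [length_cells]; omega) := by
    have := List.getElem_of_eq ho (i := j) (by simpa [shape] using hj)
    rw [← this]
    simp [shape]
  refine ⟨fun k => (o.getD (2 ^ k) (false, false)).2, fun k hk hkm => ?_, ?_⟩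
  · have hlt : 2 ^ k < o.length := by
      rw [hlen]
      exact Nat.pow_lt_pow_right (by norm_num) hkm
    have := hget _ hlt
    have hkl : ¬ 2 ^ l ≤ 2 ^ k := by
      rw [not_le]
      exact Nat.pow_lt_pow_right (by norm_num) hk
    simp only [cells, List.getElem_map, hkl, false_and, decide_false,
      Prod.mk.injEq, List.getElem_range] at this
    rw [this.1, Bool.not_false, Bool.true_and] at this
    change (o.getD (2 ^ k) (false, false)).2 = B' k
    rw [List.getD_eq_getElem _ _ hlt, this.2, Bool.eq_iff_iff, decide_eq_true_eq]
    constructor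
    · rintro ⟨i, hi, he⟩
      rwa [Nat.pow_right_injective (le_refl 2) he]
    · exact fun h => ⟨k, h, rfl⟩
  · refine List.ext_getElem (by rw [length_cells, hlen]) fun j h1 h2 => ?_
    have := hget j h1
    simp only [cells, List.getElem_map, List.getElem_range, Prod.mk.injEq] at this ⊢
    obtain ⟨h3, h4⟩ := this
    refine Prod.ext h3 ?_
    change o[j].2 = decide _
    rw [Bool.eq_iff_iff, decide_eq_true_eq]
    constructor
    · intro hv
      have : ∃ k, j = 2 ^ k := by
        cases hm : o[j].1 with
        | true =>
          rw [hm, eq_comm, decide_eq_true_eq] at h3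
          exact h3.2
        | false =>
          rw [hm, hv, Bool.not_false, Bool.true_and, eq_comm, decide_eq_true_eq] at h4
          exact ⟨h4.choose, h4.choose_spec.2⟩
      obtain ⟨k, rfl⟩ := this
      exact ⟨k, by rw [List.getD_eq_getElem _ _ h1, hv], rfl⟩
    · rintro ⟨k, hk, rfl⟩
      rwa [List.getD_eq_getElem _ _ h1] at hk

end OracleTM.Search

/-! ### Running time of the whole search -/

namespace OracleTM.Search

variable {l m : ℕ} {B B' : ℕ → Bool} {M : OracleTM} {n : ℕ} (w : Fin n → Bool)
  {b : Bool} {x : List Bool}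

/-- A bound on the time for the simulation of all oracles with `N` cells for `N` steps. -/
def levelTime (N : ℕ) : ℕ := N * simTime N + 5 * N + 8

theorem levelTime_mono {N N' : ℕ} (h : N ≤ N') : levelTime N ≤ levelTime N' := by
  unfold levelTime simTime
  gcongr

/-- `e` is the number of levels before the one with `2 ^ (m + e)` cells, where the truncation of `B`
is known to halt. Any earlier halting is covered by `hrun`, and by monotonicity each level costs at
most as much as the last. -/
theorem halts_levels (hB : ∀ k < l, B k = B' k) (h' : ∀ k, l ≤ k → B' k = false)
    (hrun : ∀ m o t b', l ≤ m → shape o = cells l B' m →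
      M.run (cellOracle o) t (M.init x) = some b' → b' = b)
    (e : ℕ) (hm : l ≤ m)
    (hhalt : M.run (cellOracle (cells l B (m + e))) (2 ^ (m + e)) (M.init x) = some b) :
    Halts w ((e + 1) * levelTime (2 ^ (m + e))) (.sim M.start) (M.init x)
      (zipper [] (cells l B' m)) (zipper [] (List.replicate (2 ^ m) none)) b := by
  induction e generalizing m with
  | zero =>
    have hs := shape_cells (m := m) (fun k (_ : k < l) => rfl) h'
    have hs' := shape_cells (m := m) hB h'
    have hv : value (cells l B' m) = 0 := by rw [← hs, value_shape]
    refine (halts_last_level w hs length_cells (fun o ho b' => hrun m o _ b' hm ho) hs' hhalt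
      (value (cells l B m)) _ hs (by omega)).mono ?_
    have h1 := value_lt (cells l B m)
    rw [← numVars_shape, hs'] at h1
    have h2 : 2 ^ numVars (cells l B' m) ≤ 2 ^ m :=
      Nat.pow_le_pow_right (by norm_num) (numVars_cells_le h' hm)
    have h3 : (value (cells l B m) + 1) * simTime (2 ^ m) ≤ 2 ^ m * simTime (2 ^ m) :=
      Nat.mul_le_mul_right _ (by omega)
    simp only [levelTime, zero_add, one_mul, add_zero]
    omega
  | succ e ih =>
    have hs := shape_cells (m := m) (fun k (_ : k < l) => rfl) h'
    have hv : value (cells l B' m) = 0 := by rw [← hs, value_shape]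
    have hpos : 0 < 2 ^ m := by positivity
    have h1 := ih (m := m + 1) (by omega) (by rwa [add_right_comm, add_assoc])
    have h2 : Halts w ((e + 1) * levelTime (2 ^ (m + 1 + e)) + 2 ^ m + 4 * (2 ^ m - 1) + 8) .extend
        (M.init x) (zipper (cells l B' m).reverse [])
        (zipper [] (List.replicate (2 ^ m) none)) b := by
      have := halts_extend w (cells l B' m) (2 ^ m - 1) (c := M.init x) (b := b)
        (t := (e + 1) * levelTime (2 ^ (m + 1 + e)))
        (by rwa [← cells_succ h' hm, Nat.sub_add_cancel hpos, ← pow_succ'])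
      rwa [length_cells, Nat.sub_add_cancel hpos] at this
    have h3 : 0 < 2 ^ numVars (cells l B' m) := by positivity
    have h4 : 2 ^ numVars (cells l B' m) ≤ 2 ^ m :=
      Nat.pow_le_pow_right (by norm_num) (numVars_cells_le h' hm)
    refine (halts_level w hs length_cells (fun o ho b' => hrun m o _ b' hm ho) h2
      (2 ^ numVars (cells l B' m) - 1) _ hs (by omega)).mono ?_
    rw [Nat.sub_add_cancel h3]
    have h5 : 2 ^ numVars (cells l B' m) * simTime (2 ^ m) ≤ 2 ^ m * simTime (2 ^ m) :=
      Nat.mul_le_mul_right _ h4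
    have h6 : levelTime (2 ^ m) ≤ levelTime (2 ^ (m + (e + 1))) :=
      levelTime_mono (Nat.pow_le_pow_right (by norm_num) (by omega))
    rw [add_mul (e + 1), one_mul, show m + 1 + e = m + (e + 1) by omega]
    have h7 : levelTime (2 ^ m) = 2 ^ m * simTime (2 ^ m) + 5 * 2 ^ m + 8 := rfl
    omega

-- The machine has only the finite string `σ` built in, as `w`. By `hsound` its first output is
-- right, and the run with a truncation of the actual oracle ensures that an output arrives in time.
open Polynomial in
theorem exists_oracleFree_of_forall_bitOracle {L : Set (List Bool)} {f : List Bool → ℕ}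
    (σ : List Bool) (hσ : ∀ k < σ.length, B k = σ.getD k false)
    (hdec : M.DecidesInTime (seqOracle B) L f)
    (hsound : ∀ ρ t x b, M.run (bitOracle (σ ++ ρ)) t (M.init x) = some b →
      (b = true ↔ x ∈ L)) :
    ∃ (M' : OracleTM) (p : Polynomial ℕ),
      M'.OracleFree ∧ M'.DecidesInTime ∅ L fun x => p.eval (f x) := by
  classical
  set l := σ.length with hl
  set B' : ℕ → Bool := fun k => σ.getD k false with hB'
  have h' : ∀ k, l ≤ k → B' k = false := fun k hk => by
    simp only [hB']
    rw [List.getD_eq_default _ _ hk]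
  have hrun : ∀ x, ∀ m o t b', l ≤ m → shape o = cells l B' m →
      M.run (cellOracle o) t (M.init x) = some b' → b' = decide (x ∈ L) := by
    intro x m o t b' hm ho hr
    obtain ⟨B'', hB'', rfl⟩ := eq_cells_of_shape_eq ho
    have hO : cellOracle (cells l B'' m) =
        bitOracle (σ ++ (List.range (m - l)).map fun i => B'' (l + i)) := by
      rw [cellOracle_cells, bitOracle]
      congr 1
      funext k
      by_cases hk : k < l
      · rw [List.getD_append _ _ _ _ hk, hB'' k hk (by omega)]
        simp [show k < m by omega, hB']
      · rw [List.getD_append_right _ _ _ _ (by omega), ← hl]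
        by_cases hkm : k < m
        · rw [List.getD_eq_getElem _ _ (by simp; omega)]
          simp [hkm, show l + (k - l) = k by omega]
        · rw [List.getD_eq_default _ _ (by simp; omega)]
          simp [hkm]
    rw [hO] at hr
    rw [Bool.eq_iff_iff, hsound _ _ _ _ hr, decide_eq_true_iff]
  set w : Fin (2 ^ l) → Bool := fun i => decide (∃ k, B' k = true ∧ (i : ℕ) = 2 ^ k) with hw
  have hcells : cells l B' l = List.ofFn fun i => (false, w i) := by
    refine List.ext_getElem (by simp [length_cells]) fun j h1 h2 => ?_
    rw [length_cells] at h1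
    simp only [cells, List.getElem_map, List.getElem_range, List.getElem_ofFn, hw, Prod.mk.injEq,
      and_true, decide_eq_false_iff_not]
    omega
  have hpos : 0 < 2 ^ l := by positivity
  set q : Polynomial ℕ := C (2 ^ (l + 1)) * X with hq
  refine ⟨MixedTM.toOracleTM (.prepare ⟨0, hpos⟩) (M.searchProgram w),
    (X + 1) * (q * (q * (2 * q + 6) + 2 * q + 4) + 5 * q + 8) + C (3 * 2 ^ l + 3),
    MixedTM.toOracleTM_oracleFree _ _, fun x => ?_⟩
  -- The binary length of `f x` gives a last level with more than `f x` cells, yet at most `2 ^ (l +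
  -- 1) * f x`; the latter is the value of `q`.
  set e := (f x).size with he
  have hf : 0 < f x := by
    by_contra! h0
    have := hdec x
    rw [Nat.le_zero.1 h0] at this
    simp [run] at this
  have hfe : f x < 2 ^ (l + e) :=
    (Nat.lt_size_self _).trans_le (Nat.pow_le_pow_right (by norm_num) (by omega))
  have hef : 2 ^ e ≤ 2 * f x := by
    have h1 : 0 < e := Nat.size_pos.2 hf
    have h2 : 2 ^ (e - 1) ≤ f x := Nat.lt_size.1 (by omega)
    calc 2 ^ e = 2 * 2 ^ (e - 1) := by rw [← pow_succ', Nat.sub_add_cancel h1]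
      _ ≤ _ := by omega
  have hef' : e ≤ f x := Nat.size_le.2 (Nat.lt_two_pow_self)
  have hhalt : M.run (cellOracle (cells l B (l + e))) (2 ^ (l + e)) (M.init x) =
      some (decide (x ∈ L)) := by
    refine run_mono ?_ hfe.le
    have := hdec x
    -- Within `f x < 2 ^ (l + e)` steps no string `0^(2^k)` with `k ≥ l + e` can be queried, so
    -- truncating the oracle changes nothing.
    rw [run_init_congr (Y := cellOracle (cells l B (l + e))) (f x) x fun y hy => ?_] at this
    · convert this
    · rw [cellOracle_cells]
      refine exists_congr fun k => ?_
      simp only [Bool.and_eq_true, decide_eq_true_eq]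
      refine ⟨fun ⟨hk, hyk⟩ => ⟨⟨?_, hk⟩, hyk⟩, fun ⟨hk, hyk⟩ => ⟨hk.2, hyk⟩⟩
      rw [hyk, List.length_replicate] at hy
      exact (Nat.pow_lt_pow_iff_right (by norm_num : 1 < 2)).1 (hy.trans_lt hfe)
  have h1 := halts_levels w hσ h' (hrun x) e le_rfl hhalt
  have h2 : Halts w (((e + 1) * levelTime (2 ^ (l + e)) + 2 ^ l + 2 ^ l + 3) + (2 ^ l - 1) + 1)
      (.prepare ⟨0, hpos⟩) (M.init x) (Tape.mk₁ []) (Tape.mk₁ []) (decide (x ∈ L)) := by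
    refine halts_prepare w ?_ (2 ^ l - 1) ⟨0, hpos⟩ (by simp only; omega)
    rw [← hcells]
    have := halts_turn w (t := (e + 1) * levelTime (2 ^ (l + e))) (c := M.init x)
      (b := decide (x ∈ L)) (cells l B' l).reverse [] (List.replicate (2 ^ l) none) []
      (by simpa only [List.reverse_reverse, List.append_nil, List.reverse_replicate] using h1)
    simpa [length_cells] using this
  have h3 : (e + 1) * levelTime (2 ^ (l + e)) ≤ (f x + 1) * levelTime (2 ^ (l + 1) * f x) := by
    refine Nat.mul_le_mul (by omega) (levelTime_mono ?_)
    rw [pow_add, pow_succ, mul_assoc]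
    exact Nat.mul_le_mul_left _ hef
  have h4 := (h2.mono (t' := (f x + 1) * levelTime (2 ^ (l + 1) * f x) + (3 * 2 ^ l + 3))
    (by omega)).run_eq (start := .prepare ⟨0, hpos⟩) ∅
  convert h4 using 2
  · simp [hq, levelTime, simTime]
  · exact (MixedTM.emb_init _ _ _).symm

end OracleTM.Search

/-! ### Runs with finite oracles are primitive recursive -/

/-- The number `k` such that `n = 2 ^ k`, if there is one. -/
def powTwoIndex (n : ℕ) : ℕ := (List.range n).findIdx fun k => 2 ^ k == n

theorem powTwoIndex_pow (k : ℕ) : powTwoIndex (2 ^ k) = k := by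
  rw [powTwoIndex, List.findIdx_eq (by simpa using Nat.lt_two_pow_self)]
  refine ⟨by simp, fun j hj => ?_⟩
  simp only [List.getElem_range, beq_eq_false_iff_ne, ne_eq]
  intro h
  exact hj.ne (Nat.pow_right_injective (le_refl 2) h)

/-- For a length `n` that is not a power of two, `powTwoIndex` returns the junk value `n`; the
equation with `0^(2^n)` then rejects the string. -/
theorem mem_seqOracle_iff {B : ℕ → Bool} {x : List Bool} :
    x ∈ seqOracle B ↔ (B (powTwoIndex x.length) &&
      decide (x = List.replicate (2 ^ powTwoIndex x.length) false)) = true := by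
  simp only [Bool.and_eq_true, decide_eq_true_eq]
  constructor
  · rintro ⟨k, hk, rfl⟩
    simp [powTwoIndex_pow, hk]
  · rintro ⟨h1, h2⟩
    exact ⟨_, h1, h2⟩

theorem primrec_two_pow : Primrec fun k : ℕ => 2 ^ k :=
  ((Primrec.nat_iterate Primrec.id (Primrec.const 1)
    (h := fun _ m => 2 * m) ((Primrec.nat_mul.comp (Primrec.const 2) Primrec.snd).to₂)).of_eq
    fun k => by
      induction k with
      | zero => rfl
      | succ k ih => rw [id, Function.iterate_succ_apply', pow_succ']; exact congrArg _ ih)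

theorem primrec_powTwoIndex : Primrec powTwoIndex :=
  Primrec.list_findIdx Primrec.list_range
    (Primrec.beq.comp (primrec_two_pow.comp Primrec.snd) Primrec.fst).to₂

theorem primrec_replicate_false : Primrec fun k : ℕ => List.replicate k false :=
  (Primrec.list_map Primrec.list_range (g := fun _ _ => false) (Primrec.const false).to₂).of_eq
    fun k => by simp

theorem primrec_eq_zeros :
    Primrec fun x : List Bool =>
      decide (x = List.replicate (2 ^ powTwoIndex x.length) false) :=
  (Primrec.beq.comp Primrec.id (primrec_replicate_false.comp (primrec_two_pow.comp
    (primrec_powTwoIndex.comp Primrec.list_length)))).of_eq fun x => by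
      rw [Bool.eq_iff_iff]
      simp

namespace OracleTM

/-- A numbering of a finite type. -/
@[reducible] noncomputable def primcodableOfFinite (α : Type) [Finite α] : Primcodable α :=
  Primcodable.ofEquiv (Fin (Nat.card α)) (Finite.equivFin α)

noncomputable instance : Primcodable Dir := primcodableOfFinite Dir
noncomputable instance (M : OracleTM) : Primcodable M.Q := primcodableOfFinite M.Q
noncomputable instance (M : OracleTM) : Primcodable M.Γ := primcodableOfFinite M.Γ

section ListTape

variable {A : Type} [Inhabited A]

/-- `Tape.move` on pairs of lists. -/
def listMove (d : Option Dir) (T : List A × List A) : List A × List A :=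
  if d = some .left then (T.1.tail, T.1.headI :: T.2)
  else if d = some .right then (T.2.headI :: T.1, T.2.tail)
  else T

/-- `OracleTM.actOn` on pairs of lists. -/
def listActOn (a : A × Option Dir) (T : List A × List A) : List A × List A :=
  listMove a.2 (T.1, a.1 :: T.2.tail)

theorem mk₂_listMove (d : Option Dir) (T : List A × List A) :
    Tape.mk₂ (listMove d T).1 (listMove d T).2 = moveHead d (Tape.mk₂ T.1 T.2) := by
  rcases d with _ | _ | _
  · simp [listMove, moveHead]
  · simp [listMove, moveHead, Tape.mk₂]
  · simp [listMove, moveHead, Tape.mk₂]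

theorem mk₂_listActOn (a : A × Option Dir) (T : List A × List A) :
    Tape.mk₂ (listActOn a T).1 (listActOn a T).2 = actOn a (Tape.mk₂ T.1 T.2) := by
  rw [listActOn, mk₂_listMove, actOn]
  simp [Tape.mk₂]

theorem head_mk₂ (l r : List A) : (Tape.mk₂ l r).head = r.headI := rfl

theorem primrec_listMove [Primcodable A] :
    Primrec₂ (listMove : Option Dir → List A × List A → List A × List A) := by
  have hl : Primrec fun p : Option Dir × List A × List A => p.2.1 := Primrec.fst.comp Primrec.snd
  have hr : Primrec fun p : Option Dir × List A × List A => p.2.2 := Primrec.snd.comp Primrec.snd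
  refine Primrec.ite (Primrec.eq.comp Primrec.fst (Primrec.const _)) ?_
    (Primrec.ite (Primrec.eq.comp Primrec.fst (Primrec.const _)) ?_ Primrec.snd)
  · exact Primrec.pair (Primrec.list_tail.comp hl)
      (Primrec.list_cons.comp (Primrec.list_headI.comp hl) hr)
  · exact Primrec.pair (Primrec.list_cons.comp (Primrec.list_headI.comp hr) hl)
      (Primrec.list_tail.comp hr)

theorem primrec_listActOn [Primcodable A] :
    Primrec₂ (listActOn : A × Option Dir → List A × List A → List A × List A) :=
  primrec_listMove.comp (Primrec.snd.comp Primrec.fst)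
    (Primrec.pair (Primrec.fst.comp Primrec.snd) (Primrec.list_cons.comp
      (Primrec.fst.comp Primrec.fst) (Primrec.list_tail.comp (Primrec.snd.comp Primrec.snd))))

end ListTape

/-- The string spelled by a list of cells. -/
def spelled (r : List (Option Bool)) : List Bool :=
  (r.takeWhile Option.isSome).map fun a => a.getD false

theorem spells_mk₂_iff (l r : List (Option Bool)) (v : List Bool) :
    Spells (Tape.mk₂ l r) v ↔ v = spelled r := by
  induction r generalizing l v with
  | nil =>
    cases v with
    | nil =>
      simp only [spells_nil, head_mk₂, spelled]
      exact ⟨fun _ => rfl, fun _ => rfl⟩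
    | cons a v =>
      simp only [spells_cons, head_mk₂, spelled]
      exact ⟨nofun, nofun⟩
  | cons a r ih =>
    have hm : (Tape.mk₂ l (a :: r)).move .right = Tape.mk₂ (a :: l) r := by simp [Tape.mk₂]
    cases v with
    | nil => cases a <;> simp [spells_nil, head_mk₂, spelled]
    | cons b v =>
      rw [spells_cons, hm, ih]
      cases a with
      | none => simp [head_mk₂, spelled]
      | some a => simp [head_mk₂, spelled, eq_comm]

theorem primrec_spelled : Primrec spelled :=
  Primrec.list_map (Primrec.list_takeWhile (Primrec.dom_finite _))
    ((Primrec.dom_finite fun a : Option Bool => a.getD false).comp Primrec.snd).to₂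

/-- The answer of `bitOracle σ` to a query. -/
def listAnswer (σ : List Bool) (r : List (Option Bool)) : Bool :=
  σ.getD (powTwoIndex (spelled r).length) false &&
    decide (spelled r = List.replicate (2 ^ powTwoIndex (spelled r).length) false)

theorem listAnswer_eq (σ : List Bool) (l r : List (Option Bool)) :
    listAnswer σ r = answer (bitOracle σ) (Tape.mk₂ l r) := by
  rw [Bool.eq_iff_iff]
  simp only [answer, spells_mk₂_iff, exists_eq_right, decide_eq_true_eq]
  exact (mem_seqOracle_iff (B := fun k => σ.getD k false)).symm

theorem primrec_listAnswer : Primrec₂ listAnswer :=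
  Primrec.and.comp
    ((Primrec.list_getD false).comp Primrec.fst (primrec_powTwoIndex.comp
      (Primrec.list_length.comp (primrec_spelled.comp Primrec.snd))))
    (primrec_eq_zeros.comp (primrec_spelled.comp Primrec.snd))

variable (M : OracleTM)

/-- Configurations with tapes given by pairs of lists. -/
abbrev ListCfg : Type :=
  M.Q × (List (Option Bool) × List (Option Bool)) × (List (Option Bool) × List (Option Bool)) ×
    (Fin (Nat.card M.K) → List M.Γ × List M.Γ)

/-- The configuration given by pairs of lists. -/
noncomputable def ListCfg.toCfg {M : OracleTM} (c : M.ListCfg) : M.Cfg where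
  state := c.1
  input := Tape.mk₂ c.2.1.1 c.2.1.2
  query := Tape.mk₂ c.2.2.1.1 c.2.2.1.2
  work := fun k => Tape.mk₂ (c.2.2.2 (Finite.equivFin M.K k)).1 (c.2.2.2 (Finite.equivFin M.K k)).2

/-- The state and the scanned symbols. -/
abbrev View : Type := M.Q × Option Bool × Option Bool × (Fin (Nat.card M.K) → M.Γ)

/-- The state and the scanned symbols of a configuration. -/
def ListCfg.view {M : OracleTM} (c : M.ListCfg) : M.View :=
  (c.1, c.2.1.2.headI, c.2.2.1.2.headI, fun i => (c.2.2.2 i).2.headI)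

/-- What `M` does in a given situation and with a given answer of the oracle: it halts, or it goes
to some state after some actions on the tapes. -/
noncomputable def effect (v : M.View) (ans : Bool) :
    (M.Q × Option Dir × (Option Bool × Option Dir) × (Fin (Nat.card M.K) → M.Γ × Option Dir)) ⊕
      Bool :=
  match M.instr v.1 v.2.1 v.2.2.1 fun k => v.2.2.2 (Finite.equivFin M.K k) with
  | .halt b => .inr b
  | .act next inMove queryAct workAct =>
    .inl (next, inMove, queryAct, fun i => workAct ((Finite.equivFin M.K).symm i))
  | .query next => .inl (next ans, none, (v.2.2.1, none), fun i => (v.2.2.2 i, none))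

/-- `OracleTM.step` with oracle `bitOracle σ` on configurations given by pairs of lists. -/
noncomputable def listStep (σ : List Bool) (c : M.ListCfg) : M.ListCfg ⊕ Bool :=
  Sum.casesOn (M.effect c.view (listAnswer σ c.2.2.1.2))
    (fun e => .inl (e.1, listMove e.2.1 c.2.1, listActOn e.2.2.1 c.2.2.1,
      fun i => listActOn (e.2.2.2 i) (c.2.2.2 i)))
    Sum.inr

theorem step_toCfg (σ : List Bool) (c : M.ListCfg) :
    M.step (bitOracle σ) c.toCfg = (M.listStep σ c).map ListCfg.toCfg id := by
  have hw {A : Type} [Inhabited A] (T : Tape A) : actOn (T.head, none) T = T := by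
    simp [actOn, moveHead]
  simp only [step, listStep, effect, ListCfg.view]
  simp only [ListCfg.toCfg, head_mk₂]
  rcases M.instr c.1 c.2.1.2.headI c.2.2.1.2.headI
    (fun k => (c.2.2.2 (Finite.equivFin M.K k)).2.headI) with b | ⟨q, im, qa, wa⟩ | next
  · rfl
  · simp [ListCfg.toCfg, mk₂_listMove, mk₂_listActOn]
  · simp only [Sum.map_inl, ListCfg.toCfg, mk₂_listMove, mk₂_listActOn, ← listAnswer_eq]
    simp only [← head_mk₂ (c.2.2.1).1, hw]
    rfl

/-- A machine has finitely many views, so `effect` is primitive recursive by `Primrec.dom_finite`;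
what remains are list operations and the answer of the oracle. -/
theorem primrec_listStep : Primrec₂ M.listStep := by
  have hc : Primrec fun p : List Bool × M.ListCfg => p.2 := Primrec.snd
  have hin : Primrec fun p : List Bool × M.ListCfg => p.2.2.1 := Primrec.fst.comp (Primrec.snd.comp hc)
  have hq : Primrec fun p : List Bool × M.ListCfg => p.2.2.2.1 :=
    Primrec.fst.comp (Primrec.snd.comp (Primrec.snd.comp hc))
  have hwork : Primrec fun p : List Bool × M.ListCfg => p.2.2.2.2 :=
    Primrec.snd.comp (Primrec.snd.comp (Primrec.snd.comp hc))
  have hview : Primrec fun p : List Bool × M.ListCfg => p.2.view :=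
    Primrec.pair (Primrec.fst.comp hc) (Primrec.pair (Primrec.list_headI.comp (Primrec.snd.comp hin))
      (Primrec.pair (Primrec.list_headI.comp (Primrec.snd.comp hq))
        (Primrec.fin_curry.2 (Primrec.list_headI.comp (Primrec.snd.comp
          (Primrec.fin_app.comp (hwork.comp Primrec.fst) Primrec.snd))))))
  have heff : Primrec fun p : List Bool × M.ListCfg =>
      M.effect p.2.view (listAnswer p.1 p.2.2.2.1.2) :=
    (Primrec.dom_finite fun u : M.View × Bool => M.effect u.1 u.2).comp
      (Primrec.pair hview (primrec_listAnswer.comp Primrec.fst (Primrec.snd.comp hq)))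
  refine Primrec.sumCasesOn heff ?_ (Primrec.sumInr.comp Primrec.snd).to₂
  refine Primrec.sumInl.comp (Primrec.pair (Primrec.fst.comp Primrec.snd) (Primrec.pair ?_
    (Primrec.pair ?_ (Primrec.fin_curry.2 ?_))))
  · exact primrec_listMove.comp (Primrec.fst.comp (Primrec.snd.comp Primrec.snd))
      (hin.comp Primrec.fst)
  · exact primrec_listActOn.comp (Primrec.fst.comp (Primrec.snd.comp (Primrec.snd.comp Primrec.snd)))
      (hq.comp Primrec.fst)
  · exact primrec_listActOn.comp
      (Primrec.fin_app.comp (Primrec.snd.comp (Primrec.snd.comp (Primrec.snd.comp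
        (Primrec.snd.comp Primrec.fst)))) Primrec.snd)
      (Primrec.fin_app.comp (hwork.comp (Primrec.fst.comp Primrec.fst)) Primrec.snd)

/-- The initial configuration, with tapes given by pairs of lists. -/
def listInit (x : List Bool) : M.ListCfg :=
  (M.start, ([], x.map some), ([], []), fun _ => ([], []))

/-- Outputs are fixed points of the iterated map, so iterating exactly `t` times detects halting
within `t` steps. -/
theorem run_eq_iterate (σ : List Bool) (t : ℕ) (c : M.ListCfg) :
    M.run (bitOracle σ) t c.toCfg =
      Sum.getRight? ((fun s : M.ListCfg ⊕ Bool => Sum.casesOn s (M.listStep σ) Sum.inr)^[t]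
        (.inl c)) := by
  induction t generalizing c with
  | zero => rfl
  | succ t ih =>
    rw [run, step_toCfg, Function.iterate_succ_apply]
    change _ = Sum.getRight? ((fun s : M.ListCfg ⊕ Bool =>
      Sum.casesOn (motive := fun _ => M.ListCfg ⊕ Bool) s (M.listStep σ) Sum.inr)^[t]
        (M.listStep σ c))
    rcases M.listStep σ c with c' | b
    · exact ih c'
    · change some b = _
      rw [Function.iterate_fixed rfl]
      rfl

theorem primrec_run : Primrec fun p : List Bool × ℕ × List Bool =>
    M.run (bitOracle p.1) p.2.1 (M.init p.2.2) := by
  have hinit : Primrec M.listInit :=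
    Primrec.pair (Primrec.const _) (Primrec.pair (Primrec.pair (Primrec.const _)
      (Primrec.list_map Primrec.id (Primrec.option_some.comp Primrec.snd).to₂)) (Primrec.const _))
  have hit : Primrec fun p : List Bool × ℕ × List Bool =>
      (fun s : M.ListCfg ⊕ Bool => Sum.casesOn (motive := fun _ => M.ListCfg ⊕ Bool) s
        (M.listStep p.1) Sum.inr)^[p.2.1] (.inl (M.listInit p.2.2)) := by
    refine Primrec.nat_iterate (Primrec.fst.comp Primrec.snd)
      (Primrec.sumInl.comp (hinit.comp (Primrec.snd.comp Primrec.snd))) ?_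
    exact Primrec.sumCasesOn Primrec.snd
      (M.primrec_listStep.comp (Primrec.fst.comp (Primrec.fst.comp Primrec.fst)) Primrec.snd).to₂
      (Primrec.sumInr.comp Primrec.snd).to₂
  refine (Primrec.sumCasesOn (f := fun p : List Bool × ℕ × List Bool =>
    (fun s : M.ListCfg ⊕ Bool => Sum.casesOn (motive := fun _ => M.ListCfg ⊕ Bool) s
        (M.listStep p.1) Sum.inr)^[p.2.1] (.inl (M.listInit p.2.2))) hit
    (g := fun _ _ => none) (h := fun _ b => some b) (Primrec.const none).to₂
    (Primrec.option_some.comp Primrec.snd).to₂).of_eq fun p => ?_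
  rw [show M.init p.2.2 = (M.listInit p.2.2).toCfg from rfl, run_eq_iterate]
  cases (fun s : M.ListCfg ⊕ Bool => Sum.casesOn (motive := fun _ => M.ListCfg ⊕ Bool) s
        (M.listStep p.1) Sum.inr)^[p.2.1] (.inl (M.listInit p.2.2)) <;> rfl

end OracleTM

/-! ### A generic sequence computable in the halting problem -/

/-- A function computed from a value of an oracle-computable function is oracle-computable. -/
theorem ComputableIn.of_comp {α σ : Type} [Primcodable α] [Primcodable σ] {O : Set (ℕ →. ℕ)}
    {g : ℕ → ℕ} (hg : Nat.RecursiveIn O g) {k : α → ℕ} (hk : Computable k) {post : α → ℕ → σ}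
    (hpost : Computable₂ post) : ComputableIn O fun a => post a (g (k a)) := by
  have hk' : Nat.RecursiveIn O (fun n => ((Encodable.decode (α := α) n).map k).getD 0 : ℕ → ℕ) := by
    refine Nat.Partrec.recursiveIn (Partrec.nat_iff.1 ?_)
    exact Computable.option_getD (Computable.option_map Computable.decode
      (hk.comp Computable.snd).to₂) (Computable.const 0)
  have hid : Nat.RecursiveIn O (fun n => n : ℕ → ℕ) :=
    Nat.Partrec.recursiveIn (Partrec.nat_iff.1 Computable.id)
  have hp : Nat.RecursiveIn O fun n =>
      Part.bind (Part.ofOption (Encodable.decode (α := α × ℕ) n)) fun a =>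
      (Part.some (post a.1 a.2)).map Encodable.encode := Nat.Partrec.recursiveIn hpost
  have hbind (g : ℕ →. ℕ) (a : ℕ) : (Part.some a >>= g) = g a := Part.bind_some a g
  refine (hp.comp (hid.pair (hg.comp hk'))).of_eq fun n => ?_
  cases hn : Encodable.decode (α := α) n with
  | none => simp [Seq.seq, hn, hbind]
  | some a => simp [Seq.seq, hn, hbind]

namespace Generic

open Nat.Partrec Encodable

/-- The code of the computation of `φ_s` on input `i`. -/
def evalCode (s i : ℕ) : ℕ := encode (Code.comp (Denumerable.ofNat Code s) (Code.const i))

/-- The code ignores its input, so its halting on its own number means that `φ_s` is defined at `i`.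
-/
theorem haltingProblem_evalCode (s i : ℕ) [Decidable ((Denumerable.ofNat Code s).eval i).Dom] :
    haltingProblem (evalCode s i) = if ((Denumerable.ofNat Code s).eval i).Dom then 1 else 0 := by
  have h : Denumerable.ofNat Code (evalCode s i) =
      Code.comp (Denumerable.ofNat Code s) (Code.const i) := Denumerable.ofNat_encode _
  unfold haltingProblem
  have h' (n : ℕ) : (Code.comp (Denumerable.ofNat Code s) (Code.const i)).eval n =
      (Denumerable.ofNat Code s).eval i := by
    change ((Code.const i).eval n >>= (Denumerable.ofNat Code s).eval) = _
    rw [Code.eval_const]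
    exact Part.bind_some _ _
  rw [h, h']
  split_ifs <;> rfl

theorem primrec_evalCode : Primrec₂ evalCode :=
  Primrec.encode.comp (Code.primrec₂_comp.comp ((Primrec.ofNat Code).comp Primrec.fst)
    (Code.primrec_const.comp Primrec.snd))

/-- Append the string with number `v` and a `false` to the string with number `i`. -/
def append (i v : ℕ) : ℕ :=
  encode (((decode (α := List Bool) i).getD [] ++ (decode (α := List Bool) v).getD []) ++ [false])

theorem primrec_append : Primrec₂ append :=
  Primrec.encode.comp (Primrec.list_concat.comp (Primrec.list_append.comp
    (Primrec.option_getD.comp (Primrec.decode.comp Primrec.fst) (Primrec.const []))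
    (Primrec.option_getD.comp (Primrec.decode.comp Primrec.snd) (Primrec.const [])))
    (Primrec.const false))

open Classical in
/-- The numbers of longer and longer strings, such that the string number `s + 1` extends the string
`σ` number `s` by the string `φ_s σ`, if this is defined. -/
noncomputable def stageNum : ℕ → ℕ
  | 0 => encode ([] : List Bool)
  | s + 1 =>
    append (stageNum s) (if h : ((Denumerable.ofNat Code s).eval (stageNum s)).Dom then
      ((Denumerable.ofNat Code s).eval (stageNum s)).get h else encode ([] : List Bool))

/-- One step of the construction; the input is `((a, (s, i)), h)`, where `h` tells whether `φ_s i`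
is defined. -/
def stepFun : ℕ →. ℕ := fun m =>
  bif m.unpair.2 == 1 then
    ((Denumerable.ofNat Code m.unpair.1.unpair.2.unpair.1).eval m.unpair.1.unpair.2.unpair.2).map
      (append m.unpair.1.unpair.2.unpair.2)
  else Part.some (append m.unpair.1.unpair.2.unpair.2 (encode ([] : List Bool)))

theorem partrec_stepFun : Partrec stepFun := by
  have h1 : Computable fun m : ℕ => m.unpair.1.unpair.2 :=
    Computable.snd.comp (Computable.unpair.comp (Computable.fst.comp Computable.unpair))
  have hs : Computable fun m : ℕ => m.unpair.1.unpair.2.unpair.1 :=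
    Computable.fst.comp (Computable.unpair.comp h1)
  have hi : Computable fun m : ℕ => m.unpair.1.unpair.2.unpair.2 :=
    Computable.snd.comp (Computable.unpair.comp h1)
  refine Partrec.cond (Primrec.beq.to_comp.comp (Computable.snd.comp Computable.unpair)
    (Computable.const 1)) ?_ (primrec_append.to_comp.comp hi (Computable.const _)).partrec
  exact Partrec.map (Code.eval_part.comp ((Computable.ofNat Code).comp hs) hi)
    (primrec_append.to_comp.comp (hi.comp Computable.fst) Computable.snd).to₂

/-- At each stage the oracle is first asked whether the extension exists; `φ_s` is run only if it
does. -/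
theorem recursiveIn_stageNum :
    Nat.RecursiveIn {(haltingProblem : ℕ →. ℕ)} (stageNum : ℕ →. ℕ) := by
  classical
  set O : Set (ℕ →. ℕ) := {(haltingProblem : ℕ →. ℕ)} with hO
  have hcode : Nat.RecursiveIn O
      (fun n => evalCode n.unpair.2.unpair.1 n.unpair.2.unpair.2 : ℕ → ℕ) := by
    refine Nat.Partrec.recursiveIn (Partrec.nat_iff.1 ?_)
    have h1 : Computable fun m : ℕ => m.unpair.2 := Computable.snd.comp Computable.unpair
    exact primrec_evalCode.to_comp.comp (Computable.fst.comp (Computable.unpair.comp h1))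
      (Computable.snd.comp (Computable.unpair.comp h1))
  have hid : Nat.RecursiveIn O (fun n => n : ℕ → ℕ) :=
    Nat.Partrec.recursiveIn (Partrec.nat_iff.1 Computable.id)
  have hzero : Nat.RecursiveIn O (fun _ => encode ([] : List Bool) : ℕ → ℕ) :=
    Nat.Partrec.recursiveIn (Partrec.nat_iff.1 (Computable.const _))
  have hpair : Nat.RecursiveIn O (fun n => Nat.pair 0 n : ℕ → ℕ) :=
    Nat.Partrec.recursiveIn (Partrec.nat_iff.1
      (Primrec₂.natPair.comp (Primrec.const 0) Primrec.id).to_comp)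
  have horacle : Nat.RecursiveIn O (haltingProblem : ℕ →. ℕ) := .oracle _ rfl
  have hstep : Nat.RecursiveIn O stepFun :=
    Nat.Partrec.recursiveIn (Partrec.nat_iff.1 partrec_stepFun)
  -- `prec` recurses on the second component of a pair; `hpair` supplies the dummy parameter `0`.
  refine ((hzero.prec (hstep.comp (hid.pair (horacle.comp hcode)))).comp hpair).of_eq fun n => ?_
  simp only [PFun.coe_val, Part.bind_eq_bind, Part.bind_some, Nat.unpair_pair]
  induction n with
  | zero => rfl
  | succ n ih =>
    simp only [ih, Part.bind_some]
    have hbind (g : ℕ →. ℕ) (a : ℕ) : (Part.some a >>= g) = g a := Part.bind_some a g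
    simp only [Seq.seq, Part.map_eq_map, Part.map_some, Part.bind_some, hbind, PFun.coe_val,
      Nat.unpair_pair, haltingProblem_evalCode, stepFun]
    split_ifs with h
    · simp only [stageNum, h, dite_true, BEq.rfl, cond_true]
      nth_rewrite 1 [← Part.some_get h]
      rw [Part.map_some]
    · simp [stageNum, h]

/-- The strings of the construction. -/
noncomputable def stage (s : ℕ) : List Bool := (decode (stageNum s)).getD []

open Classical in
theorem stage_succ (s : ℕ) : ∃ v : ℕ, (∀ u ∈ (Denumerable.ofNat Code s).eval (encode (stage s)),
    v = u) ∧ stage (s + 1) = stage s ++ (decode (α := List Bool) v).getD [] ++ [false] := by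
  have hs : encode (stage s) = stageNum s := by
    cases s with
    | zero => simp [stage, stageNum]
    | succ s => simp only [stage, stageNum, append, encodek, Option.getD_some]
  refine ⟨if h : ((Denumerable.ofNat Code s).eval (stageNum s)).Dom then
      ((Denumerable.ofNat Code s).eval (stageNum s)).get h else encode ([] : List Bool),
    fun u hu => ?_, by rw [stage, stageNum, append, encodek, Option.getD_some]; rfl⟩
  rw [hs] at hu
  obtain ⟨h, rfl⟩ := hu
  rw [dif_pos h]

theorem stage_prefix_succ (s : ℕ) : stage s <+: stage (s + 1) := by
  obtain ⟨v, -, h⟩ := stage_succ s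
  rw [h, List.append_assoc]
  exact List.prefix_append _ _

theorem stage_prefix {s s' : ℕ} (h : s ≤ s') : stage s <+: stage s' := by
  induction s', h using Nat.le_induction with
  | base => exact List.prefix_refl _
  | succ s' _ ih => exact ih.trans (stage_prefix_succ s')

/-- The reason for the final `false` in `append`: the stages grow even when `φ_s` is undefined, so
every bit of the limit is eventually fixed. -/
theorem le_length_stage (s : ℕ) : s ≤ (stage s).length := by
  induction s with
  | zero => omega
  | succ s ih =>
    obtain ⟨v, -, h⟩ := stage_succ s
    rw [h]
    simp only [List.length_append, List.length_singleton]
    omega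

/-- The limit of the strings of the construction. -/
noncomputable def limit (k : ℕ) : Bool := (stage (k + 1)).getD k false

theorem getD_eq_of_prefix {l l' : List Bool} (h : l <+: l') {k : ℕ} (hk : k < l.length) :
    l.getD k false = l'.getD k false := by
  obtain ⟨r, rfl⟩ := h
  rw [List.getD_append _ _ _ _ hk]

theorem limit_eq {s : ℕ} {k : ℕ} (hk : k < (stage s).length) :
    limit k = (stage s).getD k false := by
  rcases le_total s (k + 1) with h | h
  · exact (getD_eq_of_prefix (stage_prefix h) hk).symm
  · exact getD_eq_of_prefix (stage_prefix h) (le_length_stage (k + 1))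

/-- For a code `c` of `f`, take for `σ` the stage numbered by `c`: the next stage is the one that
appends the value of `f` at `σ`. -/
theorem limit_generic (f : List Bool →. List Bool) (hf : Partrec f) :
    ∃ σ : List Bool, (∀ k < σ.length, limit k = σ.getD k false) ∧
      ∀ ρ ∈ f σ, ∀ k < (σ ++ ρ).length, limit k = (σ ++ ρ).getD k false := by
  obtain ⟨c, hc⟩ := Code.exists_code.1 hf
  refine ⟨stage (encode c), fun k hk => limit_eq hk, fun ρ hρ k hk => ?_⟩
  obtain ⟨v, hv, h⟩ := stage_succ (encode c)
  have hv' : v = encode ρ := by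
    refine hv _ ?_
    rw [Denumerable.ofNat_encode, hc]
    simpa using hρ
  rw [hv', encodek, Option.getD_some] at h
  have hp : stage (encode c) ++ ρ <+: stage (encode c + 1) := by
    rw [h]
    exact List.prefix_append _ _
  rw [getD_eq_of_prefix hp hk]
  exact limit_eq (hk.trans_le hp.length_le)

/-! ### The properties of the generic oracle -/

theorem computableIn_seqOracle_limit : ComputableInHaltingProblem (seqOracle limit) := by
  classical
  have hk : Computable fun x : List Bool => powTwoIndex x.length + 1 :=
    (Primrec.succ.comp (primrec_powTwoIndex.comp Primrec.list_length)).to_comp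
  have hpost : Primrec₂ fun (x : List Bool) (n : ℕ) =>
      ((decode (α := List Bool) n).getD []).getD (powTwoIndex x.length) false &&
        decide (x = List.replicate (2 ^ powTwoIndex x.length) false) :=
    Primrec.and.comp ((Primrec.list_getD false).comp
      (Primrec.option_getD.comp (Primrec.decode.comp Primrec.snd) (Primrec.const []))
      (primrec_powTwoIndex.comp (Primrec.list_length.comp Primrec.fst)))
      (primrec_eq_zeros.comp Primrec.fst)
  have := ComputableIn.of_comp recursiveIn_stageNum hk hpost.to_comp
  unfold ComputableInHaltingProblem
  convert this using 2 with x
  rw [Bool.eq_iff_iff, decide_eq_true_iff, mem_seqOracle_iff]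
  rfl

/-- Otherwise genericity applies to the map sending `σ` to the negation of bit `|σ|` of `limit`, and
makes that bit differ from itself. -/
theorem not_computablePred_seqOracle_limit : ¬ ComputablePred fun x => x ∈ seqOracle limit := by
  rintro ⟨_, hg⟩
  have hf : Computable fun σ : List Bool =>
      [!decide (List.replicate (2 ^ σ.length) false ∈ seqOracle limit)] :=
    Computable.list_cons.comp (Primrec.not.to_comp.comp (hg.comp
      (primrec_replicate_false.comp (primrec_two_pow.comp Primrec.list_length)).to_comp))
      (Computable.const [])
  obtain ⟨σ, -, h⟩ := limit_generic _ hf.partrec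
  have h1 := h _ (Part.mem_some _) σ.length (by simp)
  rw [List.getD_append_right _ _ _ _ le_rfl, Nat.sub_self, List.getD_cons_zero] at h1
  have h2 : List.replicate (2 ^ σ.length) false ∈ seqOracle limit ↔ limit σ.length = true := by
    rw [mem_seqOracle_iff]
    simp [powTwoIndex_pow]
  cases hl : limit σ.length <;> simp [h2, hl] at h1

/-- Look for an extension of `σ` for which `M` gives an output that differs from `dec`; the number
`n` is that of the added bits, the running time, and the input. Enough bits are added for the
run not to depend on any further bits. -/
noncomputable def search (M : OracleTM) (dec : List Bool → Bool) (σ : List Bool) (n : ℕ) :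
    Option (List Bool) :=
  (decode (α := List Bool × ℕ × List Bool) n).bind fun p =>
    (M.run (bitOracle (σ ++ p.1)) p.2.1 (M.init p.2.2)).bind fun b =>
      bif b == dec p.2.2 then none else some (p.1 ++ List.replicate p.2.1 false)

theorem computable_search (M : OracleTM) {dec : List Bool → Bool} (hdec : Computable dec) :
    Computable₂ (search M dec) := by
  have hpair : Computable fun p : (List Bool × ℕ) × List Bool × ℕ × List Bool =>
      (p.1.1 ++ p.2.1, p.2.2) :=
    Computable.pair (Computable.list_append.comp (Computable.fst.comp Computable.fst)
      (Computable.fst.comp Computable.snd)) (Computable.snd.comp Computable.snd)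
  have hcomp {F : List Bool × ℕ × List Bool → Option Bool} (hF : Computable F) :
      Computable₂ fun (p : List Bool × ℕ) (q : List Bool × ℕ × List Bool) => F (p.1 ++ q.1, q.2) :=
    hF.comp hpair
  have hrun : Computable₂ fun (p : List Bool × ℕ) (q : List Bool × ℕ × List Bool) =>
      M.run (bitOracle (p.1 ++ q.1)) q.2.1 (M.init q.2.2) := hcomp M.primrec_run.to_comp
  have hout : Computable₂ fun (q : List Bool × ℕ × List Bool) (b : Bool) =>
      bif b == dec q.2.2 then none else some (q.1 ++ List.replicate q.2.1 false) := by
    have hq : Computable fun p : (List Bool × ℕ × List Bool) × Bool => p.1 := Computable.fst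
    have hx : Computable fun p : (List Bool × ℕ × List Bool) × Bool => dec p.1.2.2 :=
      hdec.comp (Computable.snd.comp (Computable.snd.comp hq))
    have hc : Computable fun p : (List Bool × ℕ × List Bool) × Bool => p.2 == dec p.1.2.2 :=
      (Primrec.beq (α := Bool)).to_comp.comp Computable.snd hx
    have ht : Computable fun p : (List Bool × ℕ × List Bool) × Bool =>
        List.replicate p.1.2.1 false :=
      primrec_replicate_false.to_comp.comp (Computable.fst.comp (Computable.snd.comp hq))
    have he : Computable fun p : (List Bool × ℕ × List Bool) × Bool =>
        some (p.1.1 ++ List.replicate p.1.2.1 false) :=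
      Computable.option_some.comp (Computable.list_append.comp (Computable.fst.comp hq) ht)
    exact Computable.cond hc (Computable.const none) he
  have hdecode : Computable fun p : List Bool × ℕ =>
      decode (α := List Bool × ℕ × List Bool) p.2 := Computable.decode.comp Computable.snd
  have hinner : Computable₂ fun (p : List Bool × ℕ) (q : List Bool × ℕ × List Bool) =>
      (M.run (bitOracle (p.1 ++ q.1)) q.2.1 (M.init q.2.2)).bind fun b =>
        bif b == dec q.2.2 then none else some (q.1 ++ List.replicate q.2.1 false) :=
    Computable.option_bind hrun (hout.comp (Computable.snd.comp Computable.fst) Computable.snd).to₂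
  exact Computable.option_bind hdecode hinner

theorem search_encode {M : OracleTM} {dec : List Bool → Bool} {σ ρ x : List Bool} {t : ℕ} {b : Bool}
    (h : M.run (bitOracle (σ ++ ρ)) t (M.init x) = some b) (hb : b ≠ dec x) :
    search M dec σ (encode (ρ, t, x)) = some (ρ ++ List.replicate t false) := by
  have hb' : (b == dec x) = false := by simpa using hb
  rw [search, encodek, Option.bind_some]
  simp [h, hb']

theorem exists_of_search {M : OracleTM} {dec : List Bool → Bool} {σ ρ' : List Bool} {n : ℕ}
    (h : search M dec σ n = some ρ') :
    ∃ ρ t x b, M.run (bitOracle (σ ++ ρ)) t (M.init x) = some b ∧ b ≠ dec x ∧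
      ρ' = ρ ++ List.replicate t false := by
  obtain ⟨⟨ρ, t, x⟩, -, h⟩ := Option.bind_eq_some_iff.1 h
  obtain ⟨b, hrun, h⟩ := Option.bind_eq_some_iff.1 h
  refine ⟨ρ, t, x, b, hrun, ?_⟩
  cases hb : b == dec x with
  | true => simp [hb] at h
  | false =>
    simp only [hb, cond_false, Option.some.injEq] at h
    exact ⟨by simpa using hb, h.symm⟩

theorem lowForSpeed_seqOracle_limit : LowForSpeed (seqOracle limit) := by
  classical
  intro L hL M f hdec
  obtain ⟨dec, hdecL, rfl⟩ : ∃ dec : List Bool → Bool, Computable dec ∧ L = {x | dec x = true} :=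
    ⟨fun x => decide (x ∈ L), hL.decide, by ext x; simp⟩
  obtain ⟨σ, hσ, hgen⟩ := limit_generic _ (Partrec.rfindOpt (computable_search M hdecL))
  refine OracleTM.Search.exists_oracleFree_of_forall_bitOracle σ hσ hdec ?_
  -- A wrong answer over some extension of `σ` makes the search from `σ` converge. It may find other
  -- `ρ`, `t`, `x`, but `limit` extends what it finds, so `M` errs with the actual oracle too.
  by_contra! hcon
  obtain ⟨ρ, t, x, b, hrun, hb⟩ := hcon
  have hb' : b ≠ dec x := by
    rintro rfl
    simp at hb
  have hdom : (Nat.rfindOpt (search M dec σ)).Dom :=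
    Nat.rfindOpt_dom.2 ⟨_, _, search_encode hrun hb'⟩
  obtain ⟨n, hn⟩ := Nat.rfindOpt_spec (Part.get_mem hdom)
  have hlim := hgen _ (Part.get_mem hdom)
  obtain ⟨ρ, t, x, b, hrun, hb, hρ⟩ := exists_of_search hn
  rw [hρ] at hlim
  have hX : M.run (seqOracle limit) t (M.init x) = some b := by
    rw [← hrun]
    -- Only bits `k < t` matter. Below `|σρ|` they agree by the choice of `limit`; beyond,
    -- `bitOracle` is `false` by default and `limit` is `false` because of the `t` appended zeros.
    refine OracleTM.run_init_congr t x fun y hy => exists_congr fun k => and_congr_left fun hk => ?_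
    rw [hk, List.length_replicate] at hy
    have hkt : k < t := Nat.lt_two_pow_self.trans_le hy
    rw [hlim k (by simp; omega), ← List.append_assoc]
    change _ ↔ (σ ++ ρ).getD k false = true
    rcases lt_or_ge k (σ ++ ρ).length with h | h
    · rw [List.getD_append _ _ _ _ h]
    · rw [List.getD_append_right _ _ _ _ h, List.getD_eq_default _ _ h]
      simp
  -- The wrong run and the deciding run are compared at a common time.
  have h1 := OracleTM.run_mono hX (le_max_left t (f x))
  have h2 := OracleTM.run_mono (hdec x) (le_max_right t (f x))
  rw [h1, Option.some.injEq] at h2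
  apply hb
  rw [h2]
  simp

end Generic

theorem mainTheorem12 :
    ∃ X : Set (List Bool),
      ¬ ComputablePred (fun x => x ∈ X) ∧
      LowForSpeed X ∧
      ComputableInHaltingProblem X ∧
      ∀ x ∈ X, x ∈ sparseStrings :=
  ⟨seqOracle Generic.limit, Generic.not_computablePred_seqOracle_limit,
    Generic.lowForSpeed_seqOracle_limit, Generic.computableIn_seqOracle_limit,
    fun _ ⟨k, _, h⟩ => ⟨k, h⟩⟩
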